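/- **Setting.** Let $n,J\ge 1$, $\Xi=\mathbb R^d\times\{1,\dots,J\}$, let $\Theta\subset\mathbb R^p$ be compact and convex, and let $\xi_i=(x_i,y_i)\in\Xi$, $i=1,\dots,n$. Let $\kappa,\sigma,\rho,\lambda_{\max}>0$, let $c((x,y),(x',y'))=\|x-x'\|^2+\kappa\,\mathbf 1_{y\ne y'}$ and, for $\xi=(x,y)\in\Xi$, let $\pi_0(\cdot|\xi)=\mathcal N(x,\sigma^2 I_d)\otimes\operatorname{Unif}\{1,\dots,J\}$. A function is called coercive if it is continuous with compact sublevel sets. Let $f:\mathbb R^p\times\Xi\to\mathbb R$ be such that 1. for each $y$, the function $f(\cdot,\cdot,y)$ is continuously differentiable on $\mathbb R^p\times\mathbb R^d$; 2. $c$ is nonnegative and continuous, and for each $\xi\in\Xi$ one has $c(\xi,\xi)=0$, $c(\xi,\cdot)$ is coercive, and constants $\mu_\xi\in\mathbb R$, $\lambda_\xi\ge 0$ are given with $f(\theta,\zeta)\le\mu_\xi+\frac{\lambda_\xi}{2}c(\xi,\zeta)$ for all $\theta\in\Theta$, $\zeta\in\Xi$; 3. $\pi_0(\cdot,y'|\xi)$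 is absolutely continuous with respect to Lebesgue measure for all $\xi\in\Xi$ and $y'$, and there are $a>0$ and a coercive $\psi:\Xi\to\mathbb R$ with $\mathbb E_{\zeta\sim\pi_0(\cdot|\xi)}[c(\xi,\zeta)^{1+a}]<\infty$, $\sup_{\theta\in\Theta}\|\nabla_\theta f(\theta,\xi)\|<\psi(\xi)$ and $\mathbb E_{\zeta\sim\pi_0(\cdot|\xi)}[\psi(\zeta)^{1+a}]<\infty$ for all $\xi\in\Xi$. (The conditions on $c$ and $\pi_0$ alone hold automatically for this choice.) Let $\Lambda=\bigcap_{i=1}^n[\lambda_{\xi_i},\lambda_{\max}]$, assume $\Lambda\subset(0,\infty)$, and put $\mathcal K=\Theta\times\Lambda$. For $(\theta,\lambda)\in\mathbb R^p\times\mathbb R$ let $$F(\theta,\lambda)=\lambda\rho+\frac1n\sum_{i=1}^n\sup_{\zeta\in\Xi}\{f(\theta,\zeta)-\lambda c(\xi_i,\zeta)\}\in(-\infty,+\infty],$$ and, for $\beta>0$, $m\ge1$ and samples $(\omega_\ell,z_\ell)_{\ell\ge1}$, $$F^{\beta,m}(\theta,\lambda)=\lambda\rho+\frac{\beta}{n}\sum_{i=1}^n\log\Big(\frac1m\sum_{\ell=1}^m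 e^{\left(f(\theta,x_i+\omega_\ell,z_\ell)-\lambda\|\omega_\ell\|^2-\lambda\kappa\mathbf 1_{y_i\ne z_\ell}\right)/\beta}\Big).$$ For $g:\mathbb R^q\to[-\infty,+\infty]$, let $\partial^c g(w)$ be the convex hull of all limits $\lim_k\nabla g(w_k)$, where $w_k\to w$ and, for each $k$, $g$ is real-valued near $w_k$ and differentiable at $w_k$; for locally Lipschitz $g$ this is the Clarke subdifferential. Let $\operatorname{crit}g_{|\mathcal K}=\{w\in\mathcal K:0\in\partial^c g(w)+N_{\mathcal K}(w)\}$, where $N_{\mathcal K}(w)=\{v:\langle v,u-w\rangle\le0\ \forall u\in\mathcal K\}$. Assume finally that $\Theta$ has nonempty interior, or that $F$ is real-valued and Lipschitz continuous in a neighbourhood of each point of $\mathcal K$. **Theorem.** For every $\epsilon>0$ there is $\bar\beta>0$ such that for every $\beta\in(0,\bar\beta]$ and every i.i.d. sequence $(\omega_\ell,z_\ell)_{\ell\ge1}$ with law $\mathcal N(0,\sigma^2I_d)\otimes\operatorname{Unif}\{1,\dots,J\}$, almost surely there is $\bar m\in\mathbb N$ such that for all $m\ge\bar m$, $$\operatorname{crit}F^{\beta,m}_{|\mathcal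 K}\subset\operatorname{crit}F_{|\mathcal K}+\epsilon\overline{\mathbb B},$$ where $\overline{\mathbb B}$ is the closed Euclidean unit ball. -/

import Mathlib

open Set Filter Topology MeasureTheory ProbabilityTheory
open scoped Pointwise

noncomputable section

/-! ### Clarke subdifferential, normal cone, critical set -/

section Nonsmooth

variable {E : Type*} [NormedAddCommGroup E] [InnerProductSpace ℝ E]

/-- `g` is real-valued on a neighbourhood of `w`. -/
def FiniteNear (g : E → EReal) (w : E) : Prop :=
  ∀ᶠ x in 𝓝 w, g x ≠ ⊤ ∧ g x ≠ ⊥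

/-- `g` is real-valued and Lipschitz continuous on a neighbourhood of `w`. -/
def FiniteLipschitzNear (g : E → EReal) (w : E) : Prop :=
  FiniteNear g w ∧ ∃ U ∈ 𝓝 w, ∃ L : NNReal, LipschitzOnWith L (fun x => (g x).toReal) U

/-- The normal cone (of convex analysis) to `K` at `w`. -/
def normalCone (K : Set E) (w : E) : Set E :=
  {v | ∀ u ∈ K, inner ℝ v (u - w) ≤ 0}

variable [CompleteSpace E]

/-- All limits `lim ∇g(w_k)` along sequences `w_k → w` of points near which `g` is real-valued and
at which it is differentiable. -/
def limitingGradients (g : E → EReal) (w : E) : Set E :=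
  {v | ∃ u : ℕ → E, ∃ G : ℕ → E,
    (∀ k, FiniteNear g (u k) ∧ HasGradientAt (fun x => (g x).toReal) (G k) (u k)) ∧
    Tendsto G atTop (𝓝 v) ∧ Tendsto u atTop (𝓝 w)}

/-- The Clarke subdifferential: the convex hull of the limiting gradients. -/
def clarkeSubdifferential (g : E → EReal) (w : E) : Set E :=
  convexHull ℝ (limitingGradients g w)

/-- The critical set of `g` restricted to `K`. -/
def criticalSet (g : E → EReal) (K : Set E) : Set E :=
  {w | w ∈ K ∧ (0 : E) ∈ clarkeSubdifferential g w + normalCone K w}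

end Nonsmooth

/-! ### Spaces, cost and sampling distribution -/

/-- The sample space `ℝᵈ × {1, …, J}`. -/
abbrev SampleSpace (d J : ℕ) : Type := EuclideanSpace ℝ (Fin d) × Fin J

/-- The space `ℝᵖ × ℝ` of pairs `(θ, λ)`, with its Euclidean norm. -/
abbrev ParamSpace (p : ℕ) : Type := WithLp 2 (EuclideanSpace ℝ (Fin p) × ℝ)

/-- The law `𝒩(x, σ² I) ⊗ Unif {1, …, J}`. -/
def mixedLaw {d : ℕ} (J : ℕ) (σ : ℝ) (x : EuclideanSpace ℝ (Fin d)) :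
    Measure (SampleSpace d J) :=
  (multivariateGaussian x (σ ^ 2 • (1 : Matrix (Fin d) (Fin d) ℝ))).prod
    (uniformOn (Set.univ : Set (Fin J)))

/-- The reference distribution `π₀(· | ξ) = 𝒩(x, σ² I) ⊗ Unif {1, …, J}` for `ξ = (x, y)`. -/
def mixedReference {d J : ℕ} (σ : ℝ) (ξ : SampleSpace d J) : Measure (SampleSpace d J) :=
  mixedLaw J σ ξ.1

/-- The cost `‖x - x'‖² + κ 1_{y ≠ y'}`. -/
def mixedCost {d J : ℕ} (κ : ℝ) (ξ ζ : SampleSpace d J) : ℝ :=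
  ‖ξ.1 - ζ.1‖ ^ 2 + κ * (if ξ.2 ≠ ζ.2 then 1 else 0)

/-- Continuous with compact sublevel sets. -/
def Coercive {X : Type*} [TopologicalSpace X] (ψ : X → ℝ) : Prop :=
  Continuous ψ ∧ ∀ a : ℝ, IsCompact {x | ψ x ≤ a}

/-- The assumption on the loss `f`, the cost `c` and the reference distribution `π₀`, with growth
constants `mu ξ` and `lam ξ`. -/
structure LossAssumption {p d J : ℕ} (Θ : Set (EuclideanSpace ℝ (Fin p)))
    (f : EuclideanSpace ℝ (Fin p) → SampleSpace d J → ℝ)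
    (c : SampleSpace d J → SampleSpace d J → ℝ)
    (π₀ : SampleSpace d J → Measure (SampleSpace d J))
    (mu lam : SampleSpace d J → ℝ) : Prop where
  /-- smoothness -/
  smooth : ∀ y : Fin J, ContDiff ℝ 1
    (fun q : EuclideanSpace ℝ (Fin p) × EuclideanSpace ℝ (Fin d) => f q.1 (q.2, y))
  /-- bounded growth -/
  cost_nonneg : ∀ ξ ζ, 0 ≤ c ξ ζ
  cost_continuous : Continuous (fun q : SampleSpace d J × SampleSpace d J => c q.1 q.2)
  cost_self : ∀ ξ, c ξ ξ = 0
  cost_coercive : ∀ ξ, Coercive (c ξ)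
  lam_nonneg : ∀ ξ, 0 ≤ lam ξ
  growth : ∀ ξ, ∀ θ ∈ Θ, ∀ ζ, f θ ζ ≤ mu ξ + lam ξ / 2 * c ξ ζ
  /-- reference distribution -/
  absolutelyContinuous : ∀ ξ, ∀ y' : Fin J,
    ((π₀ ξ).restrict {ζ | ζ.2 = y'}).map Prod.fst ≪ volume
  integrability : ∃ a : ℝ, 0 < a ∧ ∃ ψ : SampleSpace d J → ℝ, Coercive ψ ∧
    (∀ ξ, Integrable (fun ζ => c ξ ζ ^ (1 + a)) (π₀ ξ)) ∧
    (∀ ξ, ∀ θ ∈ Θ, ‖gradient (fun θ' => f θ' ξ) θ‖ < ψ ξ) ∧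
    (∀ ξ, Integrable (fun ζ => ψ ζ ^ (1 + a)) (π₀ ξ))

/-! ### The objectives -/

/-- `Λ = ⋂ᵢ [lam ξᵢ, lmax]`. -/
def multiplierSet {d J n : ℕ} (lam : SampleSpace d J → ℝ) (lmax : ℝ)
    (ξ : Fin n → SampleSpace d J) : Set ℝ :=
  ⋂ i, Icc (lam (ξ i)) lmax

/-- `𝒦 = Θ × Λ`. -/
def feasibleSet {p : ℕ} (Θ : Set (EuclideanSpace ℝ (Fin p))) (Λ : Set ℝ) :
    Set (ParamSpace p) :=
  {w | w.fst ∈ Θ ∧ w.snd ∈ Λ}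

/-- `φ_ξ(θ, λ) = sup_ζ (f(θ, ζ) - λ c(ξ, ζ))`, possibly `+∞`. -/
def dualFunction {p d J : ℕ} (f : EuclideanSpace ℝ (Fin p) → SampleSpace d J → ℝ)
    (c : SampleSpace d J → SampleSpace d J → ℝ) (ξ : SampleSpace d J) (w : ParamSpace p) :
    EReal :=
  ⨆ ζ : SampleSpace d J, ((f w.fst ζ - w.snd * c ξ ζ : ℝ) : EReal)

/-- `F(θ, λ) = λ ρ + (1/n) ∑ᵢ φ_{ξᵢ}(θ, λ)`. -/
def dualObjective {p d J n : ℕ} (f : EuclideanSpace ℝ (Fin p) → SampleSpace d J → ℝ)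
    (c : SampleSpace d J → SampleSpace d J → ℝ) (ρ : ℝ) (ξ : Fin n → SampleSpace d J)
    (w : ParamSpace p) : EReal :=
  ((w.snd * ρ : ℝ) : EReal) + ((1 / n : ℝ) : EReal) * ∑ i, dualFunction f c (ξ i) w

/-- `F^{β,m}(θ, λ)`, built from the first `m` terms of the sample `(ω, z)`. -/
def sampledObjective {p d J n : ℕ} (f : EuclideanSpace ℝ (Fin p) → SampleSpace d J → ℝ)
    (κ ρ : ℝ) (ξ : Fin n → SampleSpace d J) (β : ℝ) (m : ℕ)
    (ω : ℕ → EuclideanSpace ℝ (Fin d)) (z : ℕ → Fin J) (w : ParamSpace p) : ℝ :=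
  w.snd * ρ + β / n * ∑ i, Real.log (1 / m * ∑ l ∈ Finset.range m,
    Real.exp ((f w.fst ((ξ i).1 + ω l, z l) - w.snd * ‖ω l‖ ^ 2
      - w.snd * κ * (if (ξ i).2 ≠ z l then 1 else 0)) / β))

end

/-!
Write `w = (θ, λ)` and `hᵢ(w, ζ) = f(θ, ζ) - λ c(ξᵢ, ζ)`. A critical point `w` of `F^{β,m}` on `𝒦`
solves a variational inequality `⟪∇F^{β,m}(w), u - w⟫ ≥ 0` for all `u ∈ 𝒦`, in which `∇F^{β,m}` is,
up to the constant `(0, ρ)`, the average over `i` of the means of `∇hᵢ(w, ·)` under the empirical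
Gibbs weights `exp (hᵢ(w, ·) / β)`. The theorem follows from two passages to the limit in this
inequality and a description of the critical points of `F`.

* For fixed `β`, the strong law of large numbers in the Banach space `C(𝒦, V)`
  (`ae_forall_tendsto_average`) gives almost surely the uniform convergence of `∇F^{β,m}` on `𝒦`,
  as `m → ∞`, to the expression with empirical means replaced by expectations. Compactness of `𝒦`
  then reduces the claim to the limiting inequality (`ae_exists_forall_exists_dist_lt`).
* As `β → 0`, Laplace's principle (`exists_maximizer_gibbsMean`) shows that the Gibbs mean of the
  slopes `⟪∇hᵢ(w, ·), u - w⟫` is asymptotically at most the slope at some maximizer of `hᵢ(w, ·)`.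
  Hence at a limit point `w` every `u ∈ 𝒦` admits maximizers `ζᵢ` along which the slope of the
  smooth minorant of `F` that they define is nonnegative in the direction `u - w`
  (`exists_forall_exists_dist_lt`).
* Such a point is critical for `F` (`MaximumOn.mem_criticalSet`). On a suitable convex set `S` that
  contains `𝒦` near `w`, `F` is a maximum of smooth functions over a compact set. By Rademacher's
  theorem it is differentiable at points tending to `w` tangentially to `u - w`, and comparing two
  mean value expansions there yields a limiting gradient `g` with `⟪g, u - w⟫ ≥ 0`
  (`MaximumOn.exists_mem_limitingGradients`). The limiting gradients obtained in this way form a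
  compact set, so a minimax principle (`exists_forall_inner_sub_nonneg`) provides a single `g` in
  their convex hull that serves all `u`, which means `-g ∈ N_𝒦(w)`.

Only limiting gradients along interior points of `S` enter the last step. When
`Θ` has nonempty interior, `S` is the product of `Θ` with an interval slightly larger than `Λ`, and
nothing has to be known about `F` outside `Θ`; when `F` is finite and Lipschitz near `w`, `S` is a
ball around `w` (`exists_convex_growth`).
-/

/-! ### Convex geometry in finite dimension -/

section ConvexGeometry

variable {E : Type*} [NormedAddCommGroup E] [InnerProductSpace ℝ E] [FiniteDimensional ℝ E]

/-- By Carathéodory's theorem the convex hull is the image of the compact set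
`stdSimplex × A ^ (dim E + 1)` under a continuous map. -/
theorem isCompact_convexHull_of_isCompact {A : Set E} (hA : IsCompact A) :
    IsCompact (convexHull ℝ A) := by
  rcases A.eq_empty_or_nonempty with rfl | ⟨a₀, ha₀⟩
  · simp
  set N := Module.finrank ℝ E + 1
  have hcomp : IsCompact ((stdSimplex ℝ (Fin N)) ×ˢ (univ.pi fun _ : Fin N => A)) :=
    (isCompact_stdSimplex ℝ (Fin N)).prod (isCompact_univ_pi fun _ => hA)
  have himg := hcomp.image
    (f := fun q : (Fin N → ℝ) × (Fin N → E) => ∑ i, q.1 i • q.2 i) (by fun_prop)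
  convert himg using 1
  apply Subset.antisymm
  · intro x hx
    obtain ⟨ι, _, z, w, hz, haff, hw, hw1, hwx⟩ := eq_pos_convex_span_of_mem_convexHull hx
    have hcard : Fintype.card ι ≤ Fintype.card (Fin N) := by
      rw [Fintype.card_fin]
      exact haff.card_le_finrank_succ.trans
        (Nat.succ_le_succ (Submodule.finrank_le _))
    obtain ⟨e⟩ := Function.Embedding.nonempty_of_card_le hcard
    classical
    have hext : ∀ (φ : ι → E) (ψ : ι → ℝ),
        ∑ j, Function.extend e ψ 0 j • Function.extend e φ (fun _ => a₀) j = ∑ i, ψ i • φ i := by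
      intro φ ψ
      rw [← Finset.sum_subset (Finset.subset_univ (Finset.univ.map e))]
      · rw [Finset.sum_map]
        simp [e.injective.extend_apply]
      · intro j _ hj
        have hj' : ¬ ∃ i, e i = j := by simpa using hj
        simp [Function.extend_apply' _ _ _ hj']
    have hsum : ∑ j, Function.extend e w 0 j = 1 := by
      rw [← Finset.sum_subset (Finset.subset_univ (Finset.univ.map e))]
      · rw [Finset.sum_map]
        simpa [e.injective.extend_apply] using hw1
      · intro j _ hj
        have hj' : ¬ ∃ i, e i = j := by simpa using hj
        simp [Function.extend_apply' _ _ _ hj']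
    refine ⟨(Function.extend e w 0, Function.extend e z fun _ => a₀), ⟨⟨?_, hsum⟩, ?_⟩, ?_⟩
    · intro j
      by_cases hj : ∃ i, e i = j
      · obtain ⟨i, rfl⟩ := hj
        simpa [e.injective.extend_apply] using (hw i).le
      · simp [Function.extend_apply' _ _ _ hj]
    · intro j _
      by_cases hj : ∃ i, e i = j
      · obtain ⟨i, rfl⟩ := hj
        simpa [e.injective.extend_apply] using hz (mem_range_self i)
      · simpa [Function.extend_apply' _ _ _ hj] using ha₀
    · simpa [hwx] using hext z w
  · rintro _ ⟨⟨c, z⟩, ⟨⟨hc, hc1⟩, hz⟩, rfl⟩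
    exact (convex_convexHull ℝ A).sum_mem (fun i _ => hc i) hc1
      fun i _ => subset_convexHull ℝ A (hz i (mem_univ i))

/-- A minimax principle for the bilinear pairing `(g, u) ↦ ⟪g, u - w⟫` on `C × K`. If it failed,
`C` could be strictly separated from the dual cone of `K - w`; by the bipolar theorem the separating
direction is a limit of multiples of vectors `u - w`. -/
theorem exists_forall_inner_sub_nonneg {C K : Set E} (hC : IsCompact C) (hCc : Convex ℝ C)
    (hK : Convex ℝ K) {w : E} (hw : w ∈ K) (h : ∀ u ∈ K, ∃ g ∈ C, 0 ≤ inner ℝ g (u - w)) :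
    ∃ g ∈ C, ∀ u ∈ K, 0 ≤ inner ℝ g (u - w) := by
  set D : Set E := {g | ∀ u ∈ K, 0 ≤ inner ℝ g (u - w)} with hD
  by_contra! hcon
  have hdisj : Disjoint C D := by
    rw [Set.disjoint_left]
    intro g hg hgD
    obtain ⟨u, hu, hlt⟩ := hcon g hg
    exact absurd (hgD u hu) (not_le.2 hlt)
  have hDc : Convex ℝ D := by
    intro x hx y hy a b ha hb _ u hu
    rw [inner_add_left, real_inner_smul_left, real_inner_smul_left]
    exact add_nonneg (mul_nonneg ha (hx u hu)) (mul_nonneg hb (hy u hu))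
  have hDcl : IsClosed D := by
    have : D = ⋂ u ∈ K, {g : E | 0 ≤ inner ℝ g (u - w)} := by ext; simp [hD]
    rw [this]
    exact isClosed_biInter fun u _ => isClosed_le continuous_const (by fun_prop)
  obtain ⟨φ, s, t, hCs, hst, hDt⟩ :=
    geometric_hahn_banach_compact_closed hCc hC hDc hDcl hdisj
  have h0D : (0 : E) ∈ D := fun u _ => by simp
  have ht0 : t < 0 := by simpa using hDt 0 h0D
  have hφD : ∀ g ∈ D, 0 ≤ φ g := by
    intro g hg
    by_contra! hneg
    -- a multiple of `g` on which `φ` takes the value `t`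
    have hmem : (t / φ g) • g ∈ D := fun u hu => by
      rw [real_inner_smul_left]
      exact mul_nonneg (div_nonneg_of_nonpos ht0.le hneg.le) (hg u hu)
    have := hDt _ hmem
    rw [map_smul, smul_eq_mul, div_mul_cancel₀ _ hneg.ne] at this
    exact lt_irrefl _ this
  set q : E := (InnerProductSpace.toDual ℝ E).symm φ with hq
  have hφq : ∀ x, φ x = inner ℝ q x := fun x => by simp [hq]
  have hKw : Convex ℝ ((fun u => u - w) '' K) := by
    simpa [sub_eq_neg_add] using hK.translate (-w)
  set T := closure (ConvexCone.hull ℝ ((fun u => u - w) '' K) : Set E) with hT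
  have hqT : q ∈ T := by
    by_contra hqT
    obtain ⟨χ, r, hχT, hχq⟩ :=
      geometric_hahn_banach_closed_point (ConvexCone.convex _).closure isClosed_closure hqT
    have hmemT : ∀ u ∈ K, ∀ c : ℝ, 0 < c → c • (u - w) ∈ T := fun u hu c hc =>
      subset_closure ((ConvexCone.mem_hull_of_convex hKw).2 ⟨c, hc, u - w, ⟨u, hu, rfl⟩, rfl⟩)
    have hr : 0 < r := by simpa using hχT _ (hmemT w hw 1 one_pos)
    set g : E := (InnerProductSpace.toDual ℝ E).symm χ with hg
    have hχg : ∀ x, χ x = inner ℝ g x := fun x => by simp [hg]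
    have hgD : -g ∈ D := by
      intro u hu
      rw [inner_neg_left, ← hχg]
      by_contra! hneg
      have hpos : 0 < χ (u - w) := by linarith
      have := hχT _ (hmemT u hu (r / χ (u - w)) (div_pos hr hpos))
      rw [map_smul, smul_eq_mul, div_mul_cancel₀ _ hpos.ne'] at this
      exact lt_irrefl _ this
    have h1 := hφD _ hgD
    rw [hφq, inner_neg_right, real_inner_comm, ← hχg] at h1
    linarith
  obtain ⟨B, hB⟩ := hC.isBounded.exists_norm_le
  have hη : 0 < -t / (|B| + 1) := div_pos (by linarith) (by positivity)
  obtain ⟨q', hq', hdist⟩ := Metric.mem_closure_iff.1 hqT _ hη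
  obtain ⟨c, hc, _, ⟨u, hu, rfl⟩, rfl⟩ := (ConvexCone.mem_hull_of_convex hKw).1 hq'
  obtain ⟨g, hg, hge⟩ := h u hu
  have h1 : φ g < t := (hCs g hg).trans hst
  have h2 : inner ℝ g (c • (u - w)) - inner ℝ g q ≤ |B| * (-t / (|B| + 1)) := by
    rw [← inner_sub_right]
    refine (real_inner_le_norm _ _).trans ?_
    have h3 : ‖c • (u - w) - q‖ ≤ -t / (|B| + 1) := by
      rw [← dist_eq_norm, dist_comm]; exact hdist.le
    exact mul_le_mul ((hB g hg).trans (le_abs_self B)) h3 (norm_nonneg _) (abs_nonneg B)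
  have h3 : |B| * (-t / (|B| + 1)) ≤ -t := by
    rw [mul_div_assoc', div_le_iff₀ (by positivity)]
    nlinarith [abs_nonneg B]
  rw [hφq, real_inner_comm] at h1
  rw [real_inner_smul_right] at h2
  nlinarith [mul_nonneg hc.le hge]

end ConvexGeometry

/-! ### Criticality for suprema of smooth families -/

section Clarke

variable {E : Type*} [NormedAddCommGroup E] [InnerProductSpace ℝ E]

theorem isClosed_limitingGradients [CompleteSpace E] (g : E → EReal) (w : E) :
    IsClosed (limitingGradients g w) := by
  have : limitingGradients g w = (fun v => (w, v)) ⁻¹' closure {q : E × E | FiniteNear g q.1 ∧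
      HasGradientAt (fun x => (g x).toReal) q.2 q.1} := by
    ext v
    rw [mem_preimage, mem_closure_iff_seq_limit]
    constructor
    · rintro ⟨u, G, h, hG, hu⟩
      exact ⟨fun k => (u k, G k), h, hu.prodMk_nhds hG⟩
    · rintro ⟨q, hq, hlim⟩
      exact ⟨fun k => (q k).1, fun k => (q k).2, hq, hlim.snd_nhds, hlim.fst_nhds⟩
  rw [this]
  exact isClosed_closure.preimage (by fun_prop)

/-- A form of Rademacher's theorem. -/
theorem LipschitzOnWith.exists_differentiableAt [FiniteDimensional ℝ E] {φ : E → ℝ} {U : Set E}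
    {C : NNReal} (hφ : LipschitzOnWith C φ U) (hU : IsOpen U) (hne : U.Nonempty) :
    ∃ x ∈ U, DifferentiableAt ℝ φ x := by
  borelize E
  have hae := hφ.ae_differentiableWithinAt_of_mem (μ := (Measure.addHaar : Measure E))
  have hpos := hU.measure_ne_zero (Measure.addHaar : Measure E) hne
  obtain ⟨x, hxU, hx⟩ : ∃ x ∈ U, (x ∈ U → DifferentiableWithinAt ℝ φ U x) := by
    by_contra! hcon
    refine hpos (measure_mono_null (fun x hx => ?_) hae)
    exact fun h => (hcon x hx).2 (h hx)
  exact ⟨x, hxU, (hx hxU).differentiableAt (hU.mem_nhds hxU)⟩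

/-- `F` is the pointwise maximum of the family `H` on `S`, with maximizers in `Z`. -/
def MaximumOn {E Y : Type*} (F : E → EReal) (H : E → Y → ℝ) (S : Set E) (Z : Set Y) : Prop :=
  ∀ x ∈ S, ∃ y ∈ Z, (∀ y', H x y' ≤ H x y) ∧ F x = (H x y : EReal)

variable [FiniteDimensional ℝ E] {Y : Type*} {H : E → Y → ℝ} {G : E → Y → E}
  {F : E → EReal} {S : Set E} {Z : Set Y}

/-- The mean value theorem, for gradients. -/
theorem exists_inner_eq_sub {φ : E → ℝ} {γ : E → E} (h : ∀ x, HasGradientAt φ (γ x) x) (a b : E) :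
    ∃ s ∈ Icc (0 : ℝ) 1, φ b - φ a = inner ℝ (γ (a + s • (b - a))) (b - a) := by
  have hderiv : ∀ s : ℝ, HasDerivAt (fun s : ℝ => φ (a + s • (b - a)))
      (inner ℝ (γ (a + s • (b - a))) (b - a)) s := by
    intro s
    have h1 : HasDerivAt (fun s : ℝ => a + s • (b - a)) (b - a) s := by
      simpa using ((hasDerivAt_id s).smul_const (b - a)).const_add a
    have h2 := (h (a + s • (b - a))).hasFDerivAt.comp_hasDerivAt s h1
    rwa [InnerProductSpace.toDual_apply_apply] at h2
  obtain ⟨s, hs, hse⟩ := exists_hasDerivAt_eq_slope (fun s : ℝ => φ (a + s • (b - a))) _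
    (one_pos) (fun s _ => (hderiv s).continuousAt.continuousWithinAt) (fun s _ => hderiv s)
  refine ⟨s, ⟨hs.1.le, hs.2.le⟩, ?_⟩
  simp only [one_smul, add_sub_cancel, zero_smul, add_zero, sub_zero, div_one] at hse
  exact hse.symm

/-- The maximum of a smooth family is differentiable at some point of every nonempty open set on
which it is attained in a compact set: it is locally Lipschitz there. -/
theorem MaximumOn.exists_differentiableAt [TopologicalSpace Y] (hF : MaximumOn F H S Z)
    (hH : ∀ x y, HasGradientAt (fun x => H x y) (G x y) x)
    (hG : Continuous fun q : E × Y => G q.1 q.2) (hZ : IsCompact Z)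
    {U : Set E} (hU : IsOpen U) (hne : U.Nonempty) (hUS : U ⊆ S) :
    ∃ x ∈ U, DifferentiableAt ℝ (fun x => (F x).toReal) x := by
  obtain ⟨x₀, hx₀⟩ := hne
  obtain ⟨r, hr, hball⟩ := Metric.isOpen_iff.1 hU x₀ hx₀
  obtain ⟨L, hL⟩ := (((isCompact_closedBall x₀ r).prod hZ).image hG).isBounded.exists_norm_le
  have hlip : LipschitzOnWith L.toNNReal (fun x => (F x).toReal) (Metric.ball x₀ r) := by
    apply LipschitzOnWith.of_le_add_mul
    intro x hx x' hx'
    obtain ⟨y, hy, -, hFx⟩ := hF x (hUS (hball hx))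
    obtain ⟨y', -, hmax', hFx'⟩ := hF x' (hUS (hball hx'))
    obtain ⟨s, hs, hse⟩ := exists_inner_eq_sub (fun x => hH x y) x' x
    have hmem : x' + s • (x - x') ∈ Metric.closedBall x₀ r := by
      refine Metric.ball_subset_closedBall ((convex_ball x₀ r).add_smul_sub_mem hx' hx hs)
    have h1 : ‖G (x' + s • (x - x')) y‖ ≤ L.toNNReal :=
      (hL _ ⟨(_, y), ⟨hmem, hy⟩, rfl⟩).trans (Real.le_coe_toNNReal L)
    have h2 := (real_inner_le_norm (G (x' + s • (x - x')) y) (x - x')).trans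
      (mul_le_mul_of_nonneg_right h1 (norm_nonneg _))
    simp only [hFx, hFx', EReal.toReal_coe]
    rw [dist_eq_norm]
    linarith [hmax' y]
  obtain ⟨x, hx, hd⟩ := hlip.exists_differentiableAt Metric.isOpen_ball
    ⟨x₀, Metric.mem_ball_self hr⟩
  exact ⟨x, hball hx, hd⟩

/-- Fermat's rule for `F - H(·, y)`, which has a local minimum at `x`. -/
theorem MaximumOn.hasGradientAt (hF : MaximumOn F H S Z)
    (hH : ∀ x y, HasGradientAt (fun x => H x y) (G x y) x) {x : E} (hx : S ∈ 𝓝 x)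
    (hd : DifferentiableAt ℝ (fun x => (F x).toReal) x) {y : Y} (hy : F x = (H x y : EReal)) :
    HasGradientAt (fun x => (F x).toReal) (G x y) x := by
  have hmin : IsLocalMin (fun x' => (F x').toReal - H x' y) x := by
    filter_upwards [hx] with x' hx'
    obtain ⟨y', -, hmax, hF'⟩ := hF x' hx'
    simp only [hy, hF', EReal.toReal_coe, sub_self]
    linarith [hmax y]
  have h0 := hmin.hasFDerivAt_eq_zero (hd.hasFDerivAt.sub (hH x y).hasFDerivAt)
  rw [hasGradientAt_iff_hasFDerivAt, ← sub_eq_zero.1 h0]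
  exact hd.hasFDerivAt

/-- If a smooth piece that is active at `w` has a nonnegative slope towards `u`, then so has some
limiting gradient of the maximum, taken along points that approach `w` tangentially to `u - w`. -/
theorem MaximumOn.exists_mem_limitingGradients [TopologicalSpace Y] [FirstCountableTopology Y]
    (hF : MaximumOn F H S Z)
    (hH : ∀ x y, HasGradientAt (fun x => H x y) (G x y) x)
    (hG : Continuous fun q : E × Y => G q.1 q.2) (hZ : IsCompact Z)
    (hS : Convex ℝ S) (hSne : (interior S).Nonempty) {K : Set E} (hK : Convex ℝ K)
    {w u : E} (hw : w ∈ K) (hu : u ∈ K) (hKS : ∀ᶠ x in 𝓝 w, x ∈ K → x ∈ S) {y₀ : Y}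
    (hy₀ : ∀ y', H w y' ≤ H w y₀) (hslope : 0 ≤ inner ℝ (G w y₀) (u - w)) :
    ∃ g ∈ limitingGradients F w ∩ (G w '' Z), 0 ≤ inner ℝ g (u - w) := by
  obtain ⟨r, hr, hKS⟩ := Metric.eventually_nhds_iff.1 hKS
  -- steps small enough for `w + t k • (u - w)` to stay in `K` and in the part of it inside `S`
  set t : ℕ → ℝ := fun k => min 1 (r / (2 * (‖u - w‖ + 1))) / (k + 1) with ht
  have htpos : ∀ k, 0 < t k := fun k => by positivity
  have ht0 : Tendsto t atTop (𝓝 0) := by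
    simpa [ht, div_eq_mul_inv] using
      (tendsto_one_div_add_atTop_nhds_zero_nat (𝕜 := ℝ)).const_mul
        (min 1 (r / (2 * (‖u - w‖ + 1))))
  have htle : ∀ k, t k ≤ min 1 (r / (2 * (‖u - w‖ + 1))) := fun k =>
    div_le_self (by positivity) (by linarith [(Nat.cast_nonneg k : (0 : ℝ) ≤ k)])
  have hmemS : ∀ k, w + t k • (u - w) ∈ closure (interior S) := by
    intro k
    rw [hS.closure_interior_eq_closure_of_nonempty_interior hSne]
    apply subset_closure
    apply hKS
    · rw [dist_eq_norm, add_sub_cancel_left, norm_smul, Real.norm_of_nonneg (htpos k).le]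
      have h1 := (htle k).trans (min_le_right _ _)
      have h2 : t k * ‖u - w‖ ≤ r / (2 * (‖u - w‖ + 1)) * ‖u - w‖ :=
        mul_le_mul_of_nonneg_right h1 (norm_nonneg _)
      refine h2.trans_lt ?_
      rw [div_mul_eq_mul_div, div_lt_iff₀ (by positivity)]
      nlinarith [norm_nonneg (u - w)]
    · exact hK.add_smul_sub_mem hw hu ⟨(htpos k).le, (htle k).trans (min_le_left _ _)⟩
  have hx : ∀ k : ℕ, ∃ x ∈ Metric.ball (w + t k • (u - w)) (t k * (1 / (k + 1))) ∩ interior S,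
      DifferentiableAt ℝ (fun x => (F x).toReal) x := by
    intro k
    refine hF.exists_differentiableAt hH hG hZ (Metric.isOpen_ball.inter isOpen_interior) ?_
      (inter_subset_right.trans interior_subset)
    have := htpos k
    obtain ⟨x, hx, hxd⟩ := Metric.mem_closure_iff.1 (hmemS k) (t k * (1 / (k + 1))) (by positivity)
    exact ⟨x, by rwa [Metric.mem_ball'], hx⟩
  choose x hxmem hxd using hx
  have hy : ∀ k, ∃ y ∈ Z, (∀ y', H (x k) y' ≤ H (x k) y) ∧ F (x k) = (H (x k) y : EReal) :=
    fun k => hF (x k) (interior_subset (hxmem k).2)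
  choose y hyZ hymax hyF using hy
  -- the normalized displacements converge to `u - w`
  have hdir : Tendsto (fun k => (t k)⁻¹ • (x k - w)) atTop (𝓝 (u - w)) := by
    rw [tendsto_iff_dist_tendsto_zero]
    refine squeeze_zero (fun _ => dist_nonneg) (fun k => ?_)
      (tendsto_one_div_add_atTop_nhds_zero_nat (𝕜 := ℝ))
    have h1 := (hxmem k).1
    rw [Metric.mem_ball, dist_eq_norm] at h1
    have h2 : (t k)⁻¹ • (x k - w) - (u - w) = (t k)⁻¹ • (x k - (w + t k • (u - w))) := by
      rw [← sub_sub, smul_sub _ (x k - w), smul_smul, inv_mul_cancel₀ (htpos k).ne', one_smul]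
    rw [dist_eq_norm, h2, norm_smul, norm_inv, Real.norm_of_nonneg (htpos k).le,
      inv_mul_le_iff₀ (htpos k)]
    exact h1.le
  have hxw : Tendsto x atTop (𝓝 w) := by
    have h1 := (ht0.smul hdir).const_add w
    simp only [zero_smul, add_zero] at h1
    refine h1.congr fun k => ?_
    rw [smul_smul, mul_inv_cancel₀ (htpos k).ne', one_smul, add_sub_cancel]
  -- compare the two mean value expansions between `w` and `x k`
  have hmv : ∀ k, ∃ a ∈ Icc (0 : ℝ) 1, ∃ b ∈ Icc (0 : ℝ) 1,
      inner ℝ (G (w + b • (x k - w)) y₀) ((t k)⁻¹ • (x k - w)) ≤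
        inner ℝ (G (w + a • (x k - w)) (y k)) ((t k)⁻¹ • (x k - w)) := by
    intro k
    obtain ⟨a, ha, hae⟩ := exists_inner_eq_sub (fun x => hH x (y k)) w (x k)
    obtain ⟨b, hb, hbe⟩ := exists_inner_eq_sub (fun x => hH x y₀) w (x k)
    refine ⟨a, ha, b, hb, ?_⟩
    rw [real_inner_smul_right, real_inner_smul_right, ← hae, ← hbe]
    refine mul_le_mul_of_nonneg_left ?_ (inv_nonneg.2 (htpos k).le)
    linarith [hymax k y₀, hy₀ (y k)]
  choose a ha b hb hab using hmv
  have hseg : ∀ c : ℕ → ℝ, (∀ k, c k ∈ Icc (0 : ℝ) 1) →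
      Tendsto (fun k => w + c k • (x k - w)) atTop (𝓝 w) := by
    intro c hc
    have h1 : Tendsto (fun k => x k - w) atTop (𝓝 0) := by simpa using hxw.sub_const w
    have h2 : Tendsto (fun k => c k • (x k - w)) atTop (𝓝 0) := by
      refine squeeze_zero_norm (fun k => ?_) (tendsto_norm_zero.comp h1)
      rw [norm_smul, Real.norm_of_nonneg (hc k).1]
      exact mul_le_of_le_one_left (norm_nonneg _) (hc k).2
    simpa using h2.const_add w
  obtain ⟨y', hy'Z, φ, hφ, hyφ⟩ := hZ.tendsto_subseq hyZ
  have hφt := hφ.tendsto_atTop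
  refine ⟨G w y', ⟨?_, y', hy'Z, rfl⟩, ?_⟩
  · refine ⟨x ∘ φ, fun k => G (x (φ k)) (y (φ k)), fun k => ⟨?_, ?_⟩, ?_, hxw.comp hφt⟩
    · filter_upwards [mem_interior_iff_mem_nhds.1 (hxmem (φ k)).2] with x' hx'
      obtain ⟨y'', -, -, h⟩ := hF x' hx'
      simp [h]
    · exact hF.hasGradientAt hH (mem_interior_iff_mem_nhds.1 (hxmem (φ k)).2) (hxd _) (hyF _)
    · exact (hG.tendsto (w, y')).comp ((hxw.comp hφt).prodMk_nhds hyφ)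
  · have h1 := ((hG.tendsto (w, y₀)).comp
      ((hseg b hb).prodMk_nhds tendsto_const_nhds)).inner (𝕜 := ℝ) hdir
    have h2 := ((hG.tendsto (w, y')).comp
      (((hseg a ha).comp hφt).prodMk_nhds hyφ)).inner (𝕜 := ℝ) (hdir.comp hφt)
    exact hslope.trans (le_of_tendsto_of_tendsto (h1.comp hφt) h2
      (Eventually.of_forall fun k => hab (φ k)))

/-- A primal criterion for criticality of a maximum of smooth functions: every feasible direction
is one of nonnegative slope for some active piece. -/
theorem MaximumOn.mem_criticalSet [TopologicalSpace Y] [FirstCountableTopology Y]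
    (hF : MaximumOn F H S Z)
    (hH : ∀ x y, HasGradientAt (fun x => H x y) (G x y) x)
    (hG : Continuous fun q : E × Y => G q.1 q.2) (hZ : IsCompact Z)
    (hS : Convex ℝ S) (hSne : (interior S).Nonempty) {K : Set E} (hK : Convex ℝ K)
    {w : E} (hw : w ∈ K) (hKS : ∀ᶠ x in 𝓝 w, x ∈ K → x ∈ S)
    (hcrit : ∀ u ∈ K, ∃ y, (∀ y', H w y' ≤ H w y) ∧ 0 ≤ inner ℝ (G w y) (u - w)) :
    w ∈ criticalSet F K := by
  -- `limitingGradients F w` alone may be unbounded: `F` is not controlled outside `S`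
  have hcomp : IsCompact (limitingGradients F w ∩ (G w '' Z)) :=
    (hZ.image (hG.comp (by fun_prop : Continuous fun y => (w, y)))).inter_left
      (isClosed_limitingGradients F w)
  obtain ⟨g, hg, hgK⟩ := exists_forall_inner_sub_nonneg (isCompact_convexHull_of_isCompact hcomp)
    (convex_convexHull ℝ _) hK hw fun u hu => by
      obtain ⟨y, hy, hslope⟩ := hcrit u hu
      obtain ⟨g, hg, hgu⟩ := hF.exists_mem_limitingGradients hH hG hZ hS hSne hK hw hu hKS hy hslope
      exact ⟨g, subset_convexHull ℝ _ hg, hgu⟩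
  refine ⟨hw, g, convexHull_mono inter_subset_left hg, -g, fun u hu => ?_, by simp⟩
  rw [inner_neg_left]
  linarith [hgK u hu]

end Clarke

/-! ### A uniform law of large numbers -/

section LargeNumbers

/-- Uniform strong law of large numbers over a compact set `K`, phrased as continuous convergence.
It is the strong law in the Banach space `C(K, V)`. -/
theorem ae_forall_tendsto_average {X Ξ V Ω : Type*} [MetricSpace X] {K : Set X} (hK : IsCompact K)
    [TopologicalSpace Ξ] [SecondCountableTopology Ξ] [MeasurableSpace Ξ] [BorelSpace Ξ]
    [NormedAddCommGroup V] [NormedSpace ℝ V] [CompleteSpace V] {φ : X → Ξ → V}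
    (hφ : Continuous fun q : X × Ξ => φ q.1 q.2) {env : Ξ → ℝ}
    (hb : ∀ x ∈ K, ∀ ζ, ‖φ x ζ‖ ≤ env ζ) {π : Measure Ξ} (henv : Integrable env π)
    [MeasurableSpace Ω] {P : Measure Ω} [IsProbabilityMeasure P] {ζ : ℕ → Ω → Ξ}
    (hlaw : ∀ l, HasLaw (ζ l) π P) (hindep : iIndepFun ζ P) :
    ∀ᵐ s ∂P, ∀ (x : ℕ → X) (m : ℕ → ℕ), ∀ x₀ ∈ K, (∀ k, x k ∈ K) → Tendsto x atTop (𝓝 x₀) →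
      Tendsto m atTop atTop →
      Tendsto (fun k => (m k : ℝ)⁻¹ • ∑ l ∈ Finset.range (m k), φ (x k) (ζ l s)) atTop
        (𝓝 (∫ z, φ x₀ z ∂π)) := by
  rcases K.eq_empty_or_nonempty with rfl | hne
  · exact Eventually.of_forall fun s x m x₀ h => absurd h (notMem_empty _)
  have : CompactSpace K := isCompact_iff_compactSpace.1 hK
  have : Nonempty K := hne.to_subtype
  let Φ : C(Ξ, C(K, V)) := ContinuousMap.curry
    ⟨fun q : Ξ × K => φ q.2 q.1,
      hφ.comp (by fun_prop : Continuous fun q : Ξ × K => ((q.2 : X), q.1))⟩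
  have hΦ : ∀ z (x : K), Φ z x = φ x z := fun _ _ => rfl
  borelize C(K, V)
  have hΦint : Integrable Φ π := by
    refine henv.mono' Φ.continuous.stronglyMeasurable.aestronglyMeasurable
      (Eventually.of_forall fun z => ?_)
    exact (ContinuousMap.norm_le_of_nonempty _).2 fun x => hb x x.2 z
  have hslln := strong_law_ae (μ := P) (fun l s => Φ (ζ l s))
    ((integrable_map_measure Φ.continuous.stronglyMeasurable.aestronglyMeasurable
      (hlaw 0).aemeasurable).1 (by rwa [(hlaw 0).map_eq]))
    (fun i j hij => (hindep.indepFun hij).comp Φ.continuous.measurable Φ.continuous.measurable)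
    (fun i => ((hlaw i).identDistrib (hlaw 0)).comp Φ.continuous.measurable)
  filter_upwards [hslln] with s hs x m x₀ hx₀ hx hxlim hm
  have hmean : (P[fun s => Φ (ζ 0 s)]) ⟨x₀, hx₀⟩ = ∫ z, φ x₀ z ∂π := by
    have h1 : (∫ s, Φ (ζ 0 s) ∂P) = ∫ z, Φ z ∂π :=
      (hlaw 0).integral_comp Φ.continuous.stronglyMeasurable.aestronglyMeasurable
    rw [h1, ContinuousMap.integral_apply hΦint]
    rfl
  have hxK : Tendsto (fun k => (⟨x k, hx k⟩ : K)) atTop (𝓝 ⟨x₀, hx₀⟩) :=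
    tendsto_subtype_rng.2 hxlim
  have h2 := (ContinuousEval.continuous_eval.tendsto
    ((P[fun s => Φ (ζ 0 s)] : C(K, V)), (⟨x₀, hx₀⟩ : K))).comp ((hs.comp hm).prodMk_nhds hxK)
  rw [hmean] at h2
  refine h2.congr fun k => ?_
  simp [hΦ]

end LargeNumbers

/-! ### Concentration of Gibbs means -/

section Gibbs

variable {E Ξ : Type*} [NormedAddCommGroup E] [InnerProductSpace ℝ E]

/-- A continuous function dominated by `C - δ c` attains its maximum, in a set that is controlled by
any one of its values. -/
theorem exists_maximizer_of_growth [TopologicalSpace Ξ] {c h : Ξ → ℝ} (hc : Coercive c)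
    (hh : Continuous h) {C δ : ℝ} (hδ : 0 < δ) (hgrow : ∀ ζ, h ζ ≤ C - δ * c ζ) {ζ₀ : Ξ} {b : ℝ}
    (hb : b ≤ h ζ₀) :
    ∃ ζ ∈ {ζ | c ζ ≤ (C - b) / δ}, ∀ ζ', h ζ' ≤ h ζ := by
  have hmem : ∀ ζ, b ≤ h ζ → ζ ∈ {ζ | c ζ ≤ (C - b) / δ} := fun ζ hζ => by
    rw [mem_ofPred_eq, le_div_iff₀ hδ]
    linarith [hgrow ζ]
  obtain ⟨ζ, hζ, hmax⟩ := (hc.2 ((C - b) / δ)).exists_isMaxOn ⟨ζ₀, hmem ζ₀ hb⟩ hh.continuousOn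
  refine ⟨ζ, hζ, fun ζ' => ?_⟩
  by_cases h' : b ≤ h ζ'
  · exact hmax (hmem ζ' h')
  · exact (not_le.1 h').le.trans (hb.trans (hmax (hmem ζ₀ hb)))

/-- The mean of `g` under the probability measure with density proportional to `exp (h / β)` with
respect to `π`. -/
noncomputable def gibbsMean [MeasurableSpace Ξ] (π : Measure Ξ) (h : Ξ → ℝ) (g : Ξ → E)
    (β : ℝ) : E :=
  (∫ ζ, Real.exp (h ζ / β) ∂π)⁻¹ • ∫ ζ, Real.exp (h ζ / β) • g ζ ∂π

theorem norm_exp_div_smul_le {h env : Ξ → ℝ} {g : Ξ → E} {C β : ℝ} (hβ : 0 < β)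
    (hC : ∀ ζ, h ζ ≤ C) (henv : ∀ ζ, ‖g ζ‖ ≤ env ζ) (ζ : Ξ) :
    ‖Real.exp (h ζ / β) • g ζ‖ ≤ Real.exp (C / β) * env ζ := by
  rw [norm_smul, Real.norm_of_nonneg (Real.exp_pos _).le]
  exact mul_le_mul (Real.exp_le_exp.2 (div_le_div_of_nonneg_right (hC ζ) hβ.le)) (henv ζ)
    (norm_nonneg _) (Real.exp_pos _).le

variable [TopologicalSpace Ξ] [MeasurableSpace Ξ] [BorelSpace Ξ] {π : Measure Ξ}

theorem integrable_exp_div [IsProbabilityMeasure π] {h : Ξ → ℝ} (hh : Continuous h) {C β : ℝ}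
    (hβ : 0 < β) (hC : ∀ ζ, h ζ ≤ C) : Integrable (fun ζ => Real.exp (h ζ / β)) π := by
  refine (integrable_const (Real.exp (C / β))).mono'
    (Continuous.aestronglyMeasurable (by fun_prop)) (Eventually.of_forall fun ζ => ?_)
  rw [Real.norm_of_nonneg (Real.exp_pos _).le]
  exact Real.exp_le_exp.2 (div_le_div_of_nonneg_right (hC ζ) hβ.le)

theorem integral_exp_div_pos [IsProbabilityMeasure π] {h : Ξ → ℝ} (hh : Continuous h) {C β : ℝ}
    (hβ : 0 < β) (hC : ∀ ζ, h ζ ≤ C) : 0 < ∫ ζ, Real.exp (h ζ / β) ∂π :=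
  integral_exp_pos (integrable_exp_div hh hβ hC)

theorem integrable_exp_div_smul [SecondCountableTopology Ξ] {h env : Ξ → ℝ} {g : Ξ → E}
    (hh : Continuous h)
    (hg : Continuous g) {C β : ℝ} (hβ : 0 < β) (hC : ∀ ζ, h ζ ≤ C) (henv : ∀ ζ, ‖g ζ‖ ≤ env ζ)
    (hint : Integrable env π) : Integrable (fun ζ => Real.exp (h ζ / β) • g ζ) π :=
  (hint.const_mul (Real.exp (C / β))).mono' (Continuous.aestronglyMeasurable (by fun_prop))
    (Eventually.of_forall (norm_exp_div_smul_le hβ hC henv))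

/-- The Gibbs mean of a scalar exceeds `a` by at most an exponentially small amount if the scalar
exceeds `a` only where the potential is below `M - 2γ`, while the potential is above `M - γ` on a
set of positive measure. -/
theorem inner_gibbsMean_le [FiniteDimensional ℝ E] [SecondCountableTopology Ξ]
    [IsProbabilityMeasure π] {h env : Ξ → ℝ} {g : Ξ → E} (hh : Continuous h) (hg : Continuous g)
    {C β : ℝ} (hβ : 0 < β) (hC : ∀ ζ, h ζ ≤ C) (henv : ∀ ζ, ‖g ζ‖ ≤ env ζ)
    (hint : Integrable env π) {d : E} {a B M γ : ℝ} (hdB : ‖d‖ ≤ B) {O : Set Ξ}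
    (hO : MeasurableSet O) (hOpos : 0 < π.real O) (hOh : ∀ ζ ∈ O, M - γ ≤ h ζ)
    (hbad : ∀ ζ, inner ℝ (g ζ) d ≤ a ∨ h ζ ≤ M - 2 * γ) :
    inner ℝ (gibbsMean π h g β) d ≤
      a + (B * ∫ ζ, env ζ ∂π + |a|) / π.real O * Real.exp (-γ / β) := by
  set N := ∫ ζ, Real.exp (h ζ / β) ∂π
  have hNint := integrable_exp_div (π := π) hh hβ hC
  have hMint := integrable_exp_div_smul (π := π) hh hg hβ hC henv hint
  have hNpos : 0 < N := integral_exp_div_pos hh hβ hC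
  have henv0 : ∀ ζ, 0 ≤ env ζ := fun ζ => (norm_nonneg _).trans (henv ζ)
  have hB : 0 ≤ B := (norm_nonneg _).trans hdB
  have hNlow : π.real O * Real.exp ((M - γ) / β) ≤ N := by
    calc π.real O * Real.exp ((M - γ) / β) = ∫ _ in O, Real.exp ((M - γ) / β) ∂π := by
          rw [setIntegral_const, smul_eq_mul]
      _ ≤ ∫ ζ in O, Real.exp (h ζ / β) ∂π := by
          refine setIntegral_mono_on (integrable_const _).integrableOn hNint.integrableOn hO
            fun ζ hζ => ?_
          exact Real.exp_le_exp.2 (div_le_div_of_nonneg_right (hOh ζ hζ) hβ.le)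
      _ ≤ N := setIntegral_le_integral hNint (Eventually.of_forall fun ζ => (Real.exp_pos _).le)
  set A := B * ∫ ζ, env ζ ∂π + |a| with hA
  have hA0 : 0 ≤ A := add_nonneg (mul_nonneg hB (integral_nonneg henv0)) (abs_nonneg a)
  have hpt : ∀ ζ, Real.exp (h ζ / β) * (inner ℝ (g ζ) d - a) ≤
      Real.exp ((M - 2 * γ) / β) * (B * env ζ + |a|) := by
    intro ζ
    have hr : 0 ≤ B * env ζ + |a| := add_nonneg (mul_nonneg hB (henv0 ζ)) (abs_nonneg a)
    rcases hbad ζ with h1 | h1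
    · exact (mul_nonpos_of_nonneg_of_nonpos (Real.exp_pos _).le (by linarith)).trans
        (mul_nonneg (Real.exp_pos _).le hr)
    · have h2 : inner ℝ (g ζ) d - a ≤ B * env ζ + |a| := by
        have h3 : ‖g ζ‖ * ‖d‖ ≤ env ζ * B := mul_le_mul (henv ζ) hdB (norm_nonneg _) (henv0 ζ)
        linarith [real_inner_le_norm (g ζ) d, neg_abs_le a]
      exact (mul_le_mul_of_nonneg_left h2 (Real.exp_pos _).le).trans
        (mul_le_mul_of_nonneg_right
          (Real.exp_le_exp.2 (div_le_div_of_nonneg_right h1 hβ.le)) hr)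
  have hinner : inner ℝ (∫ ζ, Real.exp (h ζ / β) • g ζ ∂π) d =
      ∫ ζ, Real.exp (h ζ / β) * inner ℝ (g ζ) d ∂π := by
    rw [real_inner_comm, ← integral_inner hMint]
    refine integral_congr_ae (Eventually.of_forall fun ζ => ?_)
    simp only [real_inner_smul_right, real_inner_comm d]
  have hMd : Integrable (fun ζ => Real.exp (h ζ / β) * inner ℝ (g ζ) d) π := by
    refine (hMint.inner_const (𝕜 := ℝ) d).congr (Eventually.of_forall fun ζ => ?_)
    simp only [real_inner_smul_left]
  have hnum : inner ℝ (∫ ζ, Real.exp (h ζ / β) • g ζ ∂π) d - a * N ≤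
      Real.exp ((M - 2 * γ) / β) * A := by
    have h1 : inner ℝ (∫ ζ, Real.exp (h ζ / β) • g ζ ∂π) d - a * N =
        ∫ ζ, Real.exp (h ζ / β) * (inner ℝ (g ζ) d - a) ∂π := by
      rw [hinner, ← integral_const_mul, ← integral_sub hMd (hNint.const_mul a)]
      refine integral_congr_ae (Eventually.of_forall fun ζ => ?_)
      simp only
      ring
    have h2 : Real.exp ((M - 2 * γ) / β) * A =
        ∫ ζ, Real.exp ((M - 2 * γ) / β) * (B * env ζ + |a|) ∂π := by
      rw [integral_const_mul, integral_add (hint.const_mul B) (integrable_const _),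
        integral_const_mul, integral_const]
      simp [hA]
    rw [h1, h2]
    refine integral_mono ?_ (((hint.const_mul B).add (integrable_const _)).const_mul _) hpt
    refine (hMd.sub (hNint.const_mul a)).congr (Eventually.of_forall fun ζ => ?_)
    simp only [Pi.sub_apply]
    ring
  have hexp : Real.exp ((M - 2 * γ) / β) = Real.exp ((M - γ) / β) * Real.exp (-γ / β) := by
    rw [← Real.exp_add]
    congr 1
    ring
  rw [gibbsMean, real_inner_smul_left]
  have h3 : N⁻¹ * inner ℝ (∫ ζ, Real.exp (h ζ / β) • g ζ ∂π) d ≤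
      a + N⁻¹ * (Real.exp ((M - 2 * γ) / β) * A) := by
    have := mul_le_mul_of_nonneg_left hnum (inv_nonneg.2 hNpos.le)
    rw [mul_sub, mul_comm a N, inv_mul_cancel_left₀ hNpos.ne'] at this
    linarith
  refine h3.trans (add_le_add le_rfl ?_)
  rw [inv_mul_le_iff₀ hNpos, hexp]
  have h4 : 0 ≤ A / π.real O * Real.exp (-γ / β) :=
    mul_nonneg (div_nonneg hA0 hOpos.le) (Real.exp_pos _).le
  calc Real.exp ((M - γ) / β) * Real.exp (-γ / β) * A
      = π.real O * Real.exp ((M - γ) / β) * (A / π.real O * Real.exp (-γ / β)) := by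
        field_simp
    _ ≤ N * (A / π.real O * Real.exp (-γ / β)) := mul_le_mul_of_nonneg_right hNlow h4

/-- Laplace's principle: as the temperature tends to zero, the slope of the Gibbs mean of the
gradients is asymptotically at most the slope of the gradient at some maximizer of the potential. -/
theorem exists_maximizer_gibbsMean [FiniteDimensional ℝ E] [SecondCountableTopology Ξ]
    [IsProbabilityMeasure π] [π.IsOpenPosMeasure] {h : E → Ξ → ℝ} {g : E → Ξ → E}
    (hh : Continuous fun q : E × Ξ => h q.1 q.2) (hg : Continuous fun q : E × Ξ => g q.1 q.2)
    {c env : Ξ → ℝ} (hc : Coercive c) (hc0 : ∀ ζ, 0 ≤ c ζ) {K : Set E} {C δ : ℝ} (hδ : 0 < δ)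
    (hgrow : ∀ x ∈ K, ∀ ζ, h x ζ ≤ C - δ * c ζ) (henv : ∀ x ∈ K, ∀ ζ, ‖g x ζ‖ ≤ env ζ)
    (hint : Integrable env π) {w d : ℕ → E} {β : ℕ → ℝ} {w₀ d₀ : E} (hw : ∀ k, w k ∈ K)
    (hw₀ : w₀ ∈ K) (hwlim : Tendsto w atTop (𝓝 w₀)) (hdlim : Tendsto d atTop (𝓝 d₀))
    (hβ : ∀ k, 0 < β k) (hβlim : Tendsto β atTop (𝓝 0)) :
    ∃ ζ, (∀ ζ', h w₀ ζ' ≤ h w₀ ζ) ∧ ∀ η > 0, ∀ᶠ k in atTop,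
      inner ℝ (gibbsMean π (h (w k)) (g (w k)) (β k)) (d k) ≤ inner ℝ (g w₀ ζ) d₀ + η := by
  have hhx : ∀ x, Continuous (h x) := fun x => hh.comp (by fun_prop : Continuous fun ζ => (x, ζ))
  have hgx : ∀ x, Continuous (g x) := fun x => hg.comp (by fun_prop : Continuous fun ζ => (x, ζ))
  have hC : ∀ x ∈ K, ∀ ζ, h x ζ ≤ C := fun x hx ζ =>
    (hgrow x hx ζ).trans (sub_le_self _ (mul_nonneg hδ.le (hc0 ζ)))
  have : Nonempty Ξ := π.nonempty_of_neZero
  obtain ⟨ζ₁, -, hζ₁⟩ := exists_maximizer_of_growth hc (hhx w₀) hδ (hgrow w₀ hw₀)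
    (le_refl (h w₀ (Classical.arbitrary Ξ)))
  -- among the maximizers of the potential, choose one of largest slope
  have hAcomp : IsCompact {ζ | ∀ ζ', h w₀ ζ' ≤ h w₀ ζ} := by
    refine (hc.2 ((C - h w₀ ζ₁) / δ)).of_isClosed_subset ?_ fun ζ hζ => ?_
    · have : {ζ | ∀ ζ', h w₀ ζ' ≤ h w₀ ζ} = ⋂ ζ', {ζ | h w₀ ζ' ≤ h w₀ ζ} := by ext; simp
      rw [this]
      exact isClosed_iInter fun ζ' => isClosed_le continuous_const (hhx w₀)
    · rw [mem_ofPred_eq, le_div_iff₀ hδ]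
      linarith [hgrow w₀ hw₀ ζ, hζ ζ₁]
  obtain ⟨ζs, hζs, hslope⟩ := hAcomp.exists_isMaxOn ⟨ζ₁, hζ₁⟩
    (f := fun ζ => inner ℝ (g w₀ ζ) d₀) ((hgx w₀).inner continuous_const).continuousOn
  refine ⟨ζs, hζs, fun η hη => ?_⟩
  set M := h w₀ ζs
  set a := inner ℝ (g w₀ ζs) d₀
  set V := {ζ | inner ℝ (g w₀ ζ) d₀ < a + η / 4}
  have hV : IsOpen V := isOpen_lt ((hgx w₀).inner continuous_const) continuous_const
  set Z := {ζ | c ζ ≤ (C - M + 1) / δ}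
  have hZ : IsCompact Z := hc.2 _
  have hZout : ∀ ζ ∉ Z, ∀ x ∈ K, h x ζ ≤ M - 1 := fun ζ hζ x hx => by
    have h1 : (C - M + 1) / δ < c ζ := not_le.1 hζ
    rw [div_lt_iff₀ hδ] at h1
    linarith [hgrow x hx ζ]
  -- a gap between the maximum of the potential and its values away from the maximizers
  obtain ⟨γ, hγ, hγ1, hgap⟩ : ∃ γ > 0, 2 * γ ≤ 1 ∧ ∀ ζ ∈ Z \ V, h w₀ ζ < M - 2 * γ := by
    rcases (Z \ V).eq_empty_or_nonempty with hemp | hne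
    · exact ⟨1 / 2, by norm_num, by norm_num, by simp [hemp]⟩
    obtain ⟨ζ₂, hζ₂, hmax⟩ := (hZ.diff hV).exists_isMaxOn hne (hhx w₀).continuousOn
    have hlt : h w₀ ζ₂ < M := by
      refine lt_of_le_of_ne (hζs ζ₂) fun heq => hζ₂.2 ?_
      have : inner ℝ (g w₀ ζ₂) d₀ ≤ a := hslope (fun ζ' => by rw [heq]; exact hζs ζ')
      exact lt_of_le_of_lt this (by linarith)
    refine ⟨min (1 / 2) ((M - h w₀ ζ₂) / 4), ?_, ?_, fun ζ hζ => ?_⟩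
    · exact lt_min (by norm_num) (by linarith)
    · linarith [min_le_left (1 / 2) ((M - h w₀ ζ₂) / 4)]
    · have h1 : h w₀ ζ ≤ h w₀ ζ₂ := hmax hζ
      linarith [min_le_right (1 / 2) ((M - h w₀ ζ₂) / 4)]
  have hev1 : ∀ᶠ x in 𝓝 w₀, ∀ ζ ∈ Z \ V, h x ζ < M - 2 * γ :=
    (hZ.diff hV).eventually_forall_of_forall_eventually fun ζ hζ =>
      hh.continuousAt.eventually_lt continuousAt_const (hgap ζ hζ)
  have hev2 : ∀ᶠ q in 𝓝 (w₀, d₀), ∀ ζ ∈ Z,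
      inner ℝ (g q.1 ζ) q.2 < inner ℝ (g w₀ ζ) d₀ + η / 4 := by
    refine hZ.eventually_forall_of_forall_eventually fun ζ _ => ?_
    refine ContinuousAt.eventually_lt (f := fun q : (E × E) × Ξ => inner ℝ (g q.1.1 q.2) q.1.2)
      (g := fun q : (E × E) × Ξ => inner ℝ (g w₀ q.2) d₀ + η / 4) ?_ ?_ (by
        simp only
        linarith)
    · exact ((hg.comp (by fun_prop : Continuous fun q : (E × E) × Ξ => (q.1.1, q.2))).inner
        (by fun_prop)).continuousAt
    · exact ((((hgx w₀).comp continuous_snd).inner continuous_const).add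
        continuous_const).continuousAt
  have hev3 : ∀ᶠ q in 𝓝 w₀ ×ˢ 𝓝 ζs, M - γ < h q.1 q.2 := by
    rw [← nhds_prod_eq]
    exact continuousAt_const.eventually_lt hh.continuousAt
      (show M - γ < h (w₀, ζs).1 (w₀, ζs).2 by simp only [M]; linarith)
  obtain ⟨px, hpx, pO, hpO, hprod⟩ := eventually_prod_iff.1 hev3
  obtain ⟨O, hOsub, hOopen, hζsO⟩ := eventually_nhds_iff.1 hpO
  have hOpos : 0 < π.real O :=
    ENNReal.toReal_pos (hOopen.measure_pos π ⟨ζs, hζsO⟩).ne' (measure_ne_top π O)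
  have hlim : Tendsto (fun k => (a + η / 2) + ((‖d₀‖ + 1) * ∫ ζ, env ζ ∂π + |a + η / 2|) /
      π.real O * Real.exp (-γ / β k)) atTop (𝓝 ((a + η / 2) + ((‖d₀‖ + 1) * ∫ ζ, env ζ ∂π +
        |a + η / 2|) / π.real O * 0)) := by
    refine (Tendsto.const_mul _ (Real.tendsto_exp_atBot.comp ?_)).const_add _
    have hβ' : Tendsto β atTop (𝓝[>] 0) :=
      tendsto_nhdsWithin_iff.2 ⟨hβlim, Eventually.of_forall hβ⟩
    have := (tendsto_inv_nhdsGT_zero.comp hβ').const_mul_atTop_of_neg (neg_neg_of_pos hγ)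
    exact this.congr fun k => by simp [div_eq_mul_inv]
  have hlt := hlim.eventually_lt_const (u := a + η) (by simp; linarith)
  filter_upwards [hlt, hwlim.eventually hev1, (hwlim.prodMk_nhds hdlim).eventually hev2,
    hwlim.eventually hpx, hdlim.norm.eventually_lt_const (u := ‖d₀‖ + 1) (by linarith)]
    with k hk h1 h2 h3 h4
  refine le_trans ?_ hk.le
  refine inner_gibbsMean_le (hhx _) (hgx _) (hβ k) (hC _ (hw k)) (henv _ (hw k)) hint h4.le
    hOopen.measurableSet hOpos (M := M) (γ := γ) (fun ζ hζ => (hprod h3 (hOsub ζ hζ)).le)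
    fun ζ => ?_
  by_cases hζZ : ζ ∈ Z
  · by_cases hζV : ζ ∈ V
    · left
      have h5 : inner ℝ (g w₀ ζ) d₀ < a + η / 4 := hζV
      have h6 := h2 ζ hζZ
      linarith
    · right
      exact (h1 ζ ⟨hζZ, hζV⟩).le
  · right
    linarith [hZout ζ hζZ _ (hw k)]

end Gibbs

/-! ### Consistency of the smoothed and sampled first-order conditions -/

section Consistency

variable {E Ξ : Type*} [NormedAddCommGroup E] [InnerProductSpace ℝ E]

/-- If `φ` is continuously differentiable, critical points satisfy the variational inequality for
its gradient. -/
theorem inner_nonneg_of_mem_criticalSet [CompleteSpace E] {φ : E → ℝ} {γ : E → E}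
    (hφ : ∀ x, HasGradientAt φ (γ x) x) (hγ : Continuous γ) {K : Set E} {w : E}
    (hw : w ∈ criticalSet (fun x => (φ x : EReal)) K) : ∀ u ∈ K, 0 ≤ inner ℝ (γ w) (u - w) := by
  obtain ⟨-, g, hg, v, hv, hgv⟩ := hw
  have hsub : limitingGradients (fun x => (φ x : EReal)) w ⊆ {γ w} := by
    rintro v ⟨x, G, hG, hGv, hx⟩
    have hGγ : G = fun k => γ (x k) := funext fun k => by
      have h1 := (hG k).2
      simp only [EReal.toReal_coe] at h1
      exact h1.unique (hφ (x k))
    rw [hGγ] at hGv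
    exact tendsto_nhds_unique hGv ((hγ.tendsto w).comp hx)
  have hgw : g = γ w := by
    simpa using convexHull_mono hsub hg
  intro u hu
  have h1 := hv u hu
  rw [eq_neg_of_add_eq_zero_right hgv, inner_neg_left, hgw] at h1
  linarith

/-- The standing assumptions on a potential `h` and its gradient `g` over the parameter set `K`:
`h` tends to `-∞` at infinity uniformly in the parameter, and `g` is dominated by an integrable
function. -/
structure GibbsControl [TopologicalSpace Ξ] [MeasurableSpace Ξ] (π : Measure Ξ) (h : E → Ξ → ℝ)
    (g : E → Ξ → E) (K : Set E) : Prop where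
  continuous : Continuous fun q : E × Ξ => h q.1 q.2
  continuous_grad : Continuous fun q : E × Ξ => g q.1 q.2
  exists_bounds : ∃ (c env : Ξ → ℝ) (C δ : ℝ), Coercive c ∧ (∀ ζ, 0 ≤ c ζ) ∧ 0 < δ ∧
    (∀ x ∈ K, ∀ ζ, h x ζ ≤ C - δ * c ζ) ∧ (∀ x ∈ K, ∀ ζ, ‖g x ζ‖ ≤ env ζ) ∧ Integrable env π

/-- The gradient of `⟪b, w⟫ + a ∑ᵢ β log ∫ exp (hᵢ(w, ·) / β) dπᵢ`, with the differentiation carried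
out under the integral signs; no differentiability of this function is needed. -/
noncomputable def smoothedGradient {ι : Type*} [Fintype ι] [MeasurableSpace Ξ] (b : E) (a : ℝ)
    (π : ι → Measure Ξ) (h : ι → E → Ξ → ℝ) (g : ι → E → Ξ → E) (β : ℝ) (w : E) : E :=
  b + a • ∑ i, gibbsMean (π i) (h i w) (g i w) β

/-- The gradient of `⟪b, w⟫ + a ∑ᵢ β log (1/m ∑ₗ exp (hᵢ(w, ζᵢₗ) / β))`, with `l < m`. -/
noncomputable def sampledGradient {ι : Type*} [Fintype ι] (b : E) (a : ℝ) (h : ι → E → Ξ → ℝ)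
    (g : ι → E → Ξ → E) (β : ℝ) (m : ℕ) (ζ : ι → ℕ → Ξ) (w : E) : E :=
  b + a • ∑ i, (∑ l ∈ Finset.range m, Real.exp (h i w (ζ i l) / β))⁻¹ •
    ∑ l ∈ Finset.range m, Real.exp (h i w (ζ i l) / β) • g i w (ζ i l)

variable [FiniteDimensional ℝ E] {ι : Type*} [Fintype ι] [TopologicalSpace Ξ]
  {b : E} {a : ℝ} {h : ι → E → Ξ → ℝ} {g : ι → E → Ξ → E} {K T : Set E}

/-- For small `β` the solutions of the smoothed variational inequality are close to any set `T`
that contains every point of `K` where each feasible direction has nonnegative slope along some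
tuple of maximizers. -/
theorem exists_forall_exists_dist_lt [MeasurableSpace Ξ] [BorelSpace Ξ]
    [SecondCountableTopology Ξ] {π : ι → Measure Ξ} [∀ i, IsProbabilityMeasure (π i)]
    [∀ i, (π i).IsOpenPosMeasure] (ha : 0 ≤ a) (hK : IsCompact K)
    (hctrl : ∀ i, GibbsControl (π i) (h i) (g i) K)
    (hT : ∀ w ∈ K, (∀ u ∈ K, ∃ ζ : ι → Ξ, (∀ i, ∀ ζ', h i w ζ' ≤ h i w (ζ i)) ∧
      0 ≤ inner ℝ (b + a • ∑ i, g i w (ζ i)) (u - w)) → w ∈ T) {ε : ℝ} (hε : 0 < ε) :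
    ∃ βbar > 0, ∀ β ∈ Ioc 0 βbar, ∀ w ∈ K,
      (∀ u ∈ K, 0 ≤ inner ℝ (smoothedGradient b a π h g β w) (u - w)) →
        ∃ v ∈ T, dist w v < ε := by
  by_contra! hcon
  have hpos : ∀ k : ℕ, (0 : ℝ) < 1 / (k + 1) := fun k => by positivity
  choose β hβ w hwK hcrit hfar using fun k : ℕ => hcon _ (hpos k)
  obtain ⟨w₀, hw₀, φ, hφ, hwlim⟩ := hK.tendsto_subseq hwK
  have hβlim : Tendsto (β ∘ φ) atTop (𝓝 0) :=
    (squeeze_zero (fun k => (hβ k).1.le) (fun k => (hβ k).2)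
      (tendsto_one_div_add_atTop_nhds_zero_nat (𝕜 := ℝ))).comp hφ.tendsto_atTop
  have hw₀T : w₀ ∈ T := by
    refine hT w₀ hw₀ fun u hu => ?_
    have hdlim : Tendsto (fun k => u - w (φ k)) atTop (𝓝 (u - w₀)) := hwlim.const_sub u
    have hex : ∀ i, ∃ ζ, (∀ ζ', h i w₀ ζ' ≤ h i w₀ ζ) ∧ ∀ η > 0, ∀ᶠ k in atTop,
        inner ℝ (gibbsMean (π i) (h i (w (φ k))) (g i (w (φ k))) (β (φ k))) (u - w (φ k)) ≤
          inner ℝ (g i w₀ ζ) (u - w₀) + η := by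
      intro i
      obtain ⟨c, env, C, δ, hc, hc0, hδ, hgrow, henv, hint⟩ := (hctrl i).exists_bounds
      exact exists_maximizer_gibbsMean (hctrl i).continuous (hctrl i).continuous_grad hc hc0 hδ
        hgrow henv hint (fun k => hwK (φ k)) hw₀ hwlim hdlim (fun k => (hβ (φ k)).1) hβlim
    choose ζ hζ hslope using hex
    refine ⟨ζ, hζ, ?_⟩
    refine le_of_forall_pos_le_add fun η hη => ?_
    set η' := η / (a * Fintype.card ι + 1)
    have hden : 0 < a * Fintype.card ι + 1 := by positivity
    have hη' : 0 < η' := div_pos hη hden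
    have hle : ∀ᶠ k in atTop, 0 ≤ inner ℝ b (u - w (φ k)) +
        a * ∑ i, (inner ℝ (g i w₀ (ζ i)) (u - w₀) + η') := by
      filter_upwards [eventually_all.2 fun i => hslope i η' hη'] with k hk
      refine (hcrit (φ k) u hu).trans ?_
      rw [smoothedGradient, inner_add_left, real_inner_smul_left, sum_inner]
      exact add_le_add le_rfl (mul_le_mul_of_nonneg_left (Finset.sum_le_sum fun i _ => hk i) ha)
    have hlim := (((tendsto_const_nhds (x := b)).inner (𝕜 := ℝ) hdlim).add_const
      (a * ∑ i, (inner ℝ (g i w₀ (ζ i)) (u - w₀) + η')))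
    have h0 := ge_of_tendsto hlim hle
    rw [Finset.sum_add_distrib, Finset.sum_const, Finset.card_univ, nsmul_eq_mul, mul_add] at h0
    rw [inner_add_left, real_inner_smul_left, sum_inner]
    have h1 : a * (Fintype.card ι * η') ≤ η := by
      have : (a * Fintype.card ι + 1) * η' = η := mul_div_cancel₀ _ hden.ne'
      linarith
    linarith
  obtain ⟨k, hk⟩ := (hwlim.eventually (Metric.ball_mem_nhds w₀ hε)).exists
  exact absurd (hfar (φ k) w₀ hw₀T) (not_le.2 hk)

/-- Almost surely, the sampled gradients converge continuously on `K` to the smoothed one. -/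
theorem ae_forall_tendsto_sampledGradient [MeasurableSpace Ξ] [BorelSpace Ξ]
    [SecondCountableTopology Ξ] {π : ι → Measure Ξ} [∀ i, IsProbabilityMeasure (π i)]
    (hK : IsCompact K) (hctrl : ∀ i, GibbsControl (π i) (h i) (g i) K) {β : ℝ} (hβ : 0 < β)
    {Ω : Type*} [MeasurableSpace Ω] {P : Measure Ω} [IsProbabilityMeasure P]
    {ζ : ι → ℕ → Ω → Ξ} (hlaw : ∀ i l, HasLaw (ζ i l) (π i) P)
    (hindep : ∀ i, iIndepFun (ζ i) P) :
    ∀ᵐ s ∂P, ∀ (x : ℕ → E) (m : ℕ → ℕ), ∀ x₀ ∈ K, (∀ k, x k ∈ K) → Tendsto x atTop (𝓝 x₀) →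
      Tendsto m atTop atTop →
      Tendsto (fun k => sampledGradient b a h g β (m k) (fun i l => ζ i l s) (x k)) atTop
        (𝓝 (smoothedGradient b a π h g β x₀)) := by
  have hN : ∀ i, ∀ᵐ s ∂P, ∀ (x : ℕ → E) (m : ℕ → ℕ), ∀ x₀ ∈ K, (∀ k, x k ∈ K) →
      Tendsto x atTop (𝓝 x₀) → Tendsto m atTop atTop →
      Tendsto (fun k => (m k : ℝ)⁻¹ • ∑ l ∈ Finset.range (m k), Real.exp (h i (x k) (ζ i l s) / β))
        atTop (𝓝 (∫ z, Real.exp (h i x₀ z / β) ∂(π i))) := by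
    intro i
    obtain ⟨c, env, C, δ, hc, hc0, hδ, hgrow, henv, hint⟩ := (hctrl i).exists_bounds
    have hcont := (hctrl i).continuous
    refine ae_forall_tendsto_average (φ := fun x z => Real.exp (h i x z / β)) hK (by fun_prop)
      (env := fun _ => Real.exp (C / β)) (fun x hx z => ?_) (integrable_const _) (hlaw i) (hindep i)
    rw [Real.norm_of_nonneg (Real.exp_pos _).le]
    exact Real.exp_le_exp.2 (div_le_div_of_nonneg_right
      ((hgrow x hx z).trans (sub_le_self _ (mul_nonneg hδ.le (hc0 z)))) hβ.le)
  have hM : ∀ i, ∀ᵐ s ∂P, ∀ (x : ℕ → E) (m : ℕ → ℕ), ∀ x₀ ∈ K, (∀ k, x k ∈ K) →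
      Tendsto x atTop (𝓝 x₀) → Tendsto m atTop atTop →
      Tendsto (fun k => (m k : ℝ)⁻¹ • ∑ l ∈ Finset.range (m k),
        Real.exp (h i (x k) (ζ i l s) / β) • g i (x k) (ζ i l s))
        atTop (𝓝 (∫ z, Real.exp (h i x₀ z / β) • g i x₀ z ∂(π i))) := by
    intro i
    obtain ⟨c, env, C, δ, hc, hc0, hδ, hgrow, henv, hint⟩ := (hctrl i).exists_bounds
    have hcont := (hctrl i).continuous
    have hcont' := (hctrl i).continuous_grad
    exact ae_forall_tendsto_average (φ := fun x z => Real.exp (h i x z / β) • g i x z) hK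
      (by fun_prop) (env := fun z => Real.exp (C / β) * env z)
      (fun x hx z => norm_exp_div_smul_le hβ (fun z => (hgrow x hx z).trans
        (sub_le_self _ (mul_nonneg hδ.le (hc0 z)))) (henv x hx) z) (hint.const_mul _) (hlaw i)
      (hindep i)
  filter_upwards [eventually_all.2 hN, eventually_all.2 hM] with s hsN hsM x m x₀ hx₀ hx hxlim hm
  refine Tendsto.const_add _ (Tendsto.const_smul (tendsto_finsetSum _ fun i _ => ?_) _)
  obtain ⟨c, env, C, δ, hc, hc0, hδ, hgrow, henv, hint⟩ := (hctrl i).exists_bounds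
  have hcont := (hctrl i).continuous
  have hpos : 0 < ∫ z, Real.exp (h i x₀ z / β) ∂(π i) :=
    integral_exp_div_pos (hcont.comp (by fun_prop : Continuous fun z => (x₀, z))) hβ
      fun z => (hgrow x₀ hx₀ z).trans (sub_le_self _ (mul_nonneg hδ.le (hc0 z)))
  have h1 := ((hsN i x m x₀ hx₀ hx hxlim hm).inv₀ hpos.ne').smul
    (hsM i x m x₀ hx₀ hx hxlim hm)
  refine h1.congr' ?_
  filter_upwards [hm.eventually_gt_atTop 0] with k hk
  have hk' : (m k : ℝ) ≠ 0 := by exact_mod_cast hk.ne'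
  rw [smul_eq_mul, mul_inv, inv_inv, smul_smul, mul_right_comm, mul_inv_cancel₀ hk', one_mul]

/-- If the solutions of the smoothed variational inequality are within distance `ε` of `T`, then so
are almost surely, for large samples, the solutions of the sampled one. -/
theorem ae_exists_forall_exists_dist_lt [MeasurableSpace Ξ] [BorelSpace Ξ]
    [SecondCountableTopology Ξ] {π : ι → Measure Ξ} [∀ i, IsProbabilityMeasure (π i)]
    (hK : IsCompact K) (hctrl : ∀ i, GibbsControl (π i) (h i) (g i) K) {β : ℝ} (hβ : 0 < β)
    {ε : ℝ} (hnear : ∀ w ∈ K,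
      (∀ u ∈ K, 0 ≤ inner ℝ (smoothedGradient b a π h g β w) (u - w)) → ∃ v ∈ T, dist w v < ε)
    {Ω : Type*} [MeasurableSpace Ω] {P : Measure Ω} [IsProbabilityMeasure P]
    {ζ : ι → ℕ → Ω → Ξ} (hlaw : ∀ i l, HasLaw (ζ i l) (π i) P)
    (hindep : ∀ i, iIndepFun (ζ i) P) :
    ∀ᵐ s ∂P, ∃ mbar : ℕ, ∀ m ≥ mbar, ∀ w ∈ K,
      (∀ u ∈ K, 0 ≤ inner ℝ (sampledGradient b a h g β m (fun i l => ζ i l s) w) (u - w)) →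
        ∃ v ∈ T, dist w v < ε := by
  filter_upwards [ae_forall_tendsto_sampledGradient (b := b) (a := a) hK hctrl hβ hlaw hindep]
    with s hs
  by_contra! hcon
  choose m hm w hwK hcrit hfar using hcon
  obtain ⟨w₀, hw₀, φ, hφ, hwlim⟩ := hK.tendsto_subseq hwK
  have hmlim : Tendsto (m ∘ φ) atTop atTop :=
    (tendsto_atTop_mono hm tendsto_id).comp hφ.tendsto_atTop
  have hgrad := hs (w ∘ φ) (m ∘ φ) w₀ hw₀ (fun k => hwK (φ k)) hwlim hmlim
  obtain ⟨v, hv, hdist⟩ := hnear w₀ hw₀ fun u hu =>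
    ge_of_tendsto' (hgrad.inner (𝕜 := ℝ) (hwlim.const_sub u)) fun k => hcrit (φ k) u hu
  obtain ⟨k, hk⟩ := ((hwlim.dist tendsto_const_nhds).eventually_lt_const hdist).exists
  exact absurd (hfar (φ k) v hv) (not_le.2 hk)

end Consistency

/-! ### The sampling distribution -/

section SamplingLaw

variable {d J : ℕ}

theorem isOpenPosMeasure_stdGaussian {E : Type*} [NormedAddCommGroup E] [InnerProductSpace ℝ E]
    [FiniteDimensional ℝ E] [MeasurableSpace E] [BorelSpace E] :
    (stdGaussian E).IsOpenPosMeasure := by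
  have : (gaussianReal 0 1).IsOpenPosMeasure :=
    (gaussianReal_absolutelyContinuous' 0 one_ne_zero).isOpenPosMeasure
  refine Continuous.isOpenPosMeasure_map (by fun_prop) fun v => ?_
  exact ⟨fun i => (stdOrthonormalBasis ℝ E).repr v i, (stdOrthonormalBasis ℝ E).sum_repr v⟩

open scoped MatrixOrder in
theorem sqrt_sq_smul_one {σ : ℝ} (hσ : 0 ≤ σ) :
    CFC.sqrt (σ ^ 2 • (1 : Matrix (Fin d) (Fin d) ℝ)) = σ • 1 := by
  apply CFC.sqrt_unique
  · simp [sq, smul_smul]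
  · rw [Matrix.nonneg_iff_posSemidef]
    exact Matrix.PosSemidef.one.smul hσ

theorem isOpenPosMeasure_mixedLaw (hJ : 0 < J) {σ : ℝ} (hσ : 0 < σ)
    (x : EuclideanSpace ℝ (Fin d)) : (mixedLaw J σ x).IsOpenPosMeasure := by
  have := isOpenPosMeasure_stdGaussian (E := EuclideanSpace ℝ (Fin d))
  have h1 : (multivariateGaussian x
      (σ ^ 2 • (1 : Matrix (Fin d) (Fin d) ℝ))).IsOpenPosMeasure := by
    rw [multivariateGaussian, sqrt_sq_smul_one hσ.le]
    refine Continuous.isOpenPosMeasure_map (by fun_prop) fun v => ⟨σ⁻¹ • (v - x), ?_⟩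
    simp [smul_smul, hσ.ne']
  have : NeZero J := ⟨hJ.ne'⟩
  have h2 : (uniformOn (univ : Set (Fin J))).IsOpenPosMeasure := by
    refine ⟨fun U _ hU h0 => ?_⟩
    rw [uniformOn_eq_zero_iff finite_univ, univ_inter] at h0
    exact hU.ne_empty h0
  exact Measure.prod.instIsOpenPosMeasure

theorem isProbabilityMeasure_mixedLaw (hJ : 0 < J) (σ : ℝ) (x : EuclideanSpace ℝ (Fin d)) :
    IsProbabilityMeasure (mixedLaw J σ x) := by
  have : NeZero J := ⟨hJ.ne'⟩
  unfold mixedLaw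
  infer_instance

theorem hasLaw_shift (hJ : 0 < J) (σ : ℝ) (x : EuclideanSpace ℝ (Fin d)) :
    HasLaw (fun ζ : SampleSpace d J => (x + ζ.1, ζ.2)) (mixedLaw J σ x) (mixedLaw J σ 0) where
  aemeasurable := by fun_prop
  map_eq := by
    have : NeZero J := ⟨hJ.ne'⟩
    have h1 : multivariateGaussian x (σ ^ 2 • (1 : Matrix (Fin d) (Fin d) ℝ)) =
        (multivariateGaussian 0 (σ ^ 2 • (1 : Matrix (Fin d) (Fin d) ℝ))).map (fun v => x + v) := by
      rw [multivariateGaussian, multivariateGaussian, Measure.map_map (by fun_prop) (by fun_prop)]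
      congr 1
      ext1 v
      simp
    have h2 := Measure.map_prod_map
      (multivariateGaussian 0 (σ ^ 2 • (1 : Matrix (Fin d) (Fin d) ℝ)))
      (uniformOn (univ : Set (Fin J))) (measurable_const_add x) measurable_id
    rw [mixedLaw, mixedLaw, h1, Measure.map_id] at *
    exact h2.symm

end SamplingLaw

/-! ### The potentials and their gradients -/

section Potential

variable {p d J n : ℕ} {f : EuclideanSpace ℝ (Fin p) → SampleSpace d J → ℝ} {κ ρ : ℝ}

/-- The function `f(θ, ζ) - λ c(ξ, ζ)` of which `dualFunction` is the supremum. -/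
noncomputable def potential (f : EuclideanSpace ℝ (Fin p) → SampleSpace d J → ℝ) (κ : ℝ)
    (ξ : SampleSpace d J) (w : ParamSpace p) (ζ : SampleSpace d J) : ℝ :=
  f w.fst ζ - w.snd * mixedCost κ ξ ζ

/-- The gradient `(∇_θ f(θ, ζ), -c(ξ, ζ))` of the potential in `(θ, λ)`. -/
noncomputable def potentialGradient (f : EuclideanSpace ℝ (Fin p) → SampleSpace d J → ℝ) (κ : ℝ)
    (ξ : SampleSpace d J) (w : ParamSpace p) (ζ : SampleSpace d J) : ParamSpace p :=
  WithLp.toLp 2 (gradient (fun θ => f θ ζ) w.fst, -mixedCost κ ξ ζ)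

theorem continuous_mixedCost (κ : ℝ) (ξ : SampleSpace d J) : Continuous (mixedCost κ ξ) := by
  refine continuous_prod_of_discrete_right.2 fun y => ?_
  change Continuous fun v => ‖ξ.1 - v‖ ^ 2 + κ * (if ξ.2 ≠ y then 1 else 0)
  exact (by fun_prop : Continuous fun v => ‖ξ.1 - v‖ ^ 2).add continuous_const

/-- For each label `y`, the loss `f(·, ·, y)` is continuously differentiable. -/
def SmoothLoss (f : EuclideanSpace ℝ (Fin p) → SampleSpace d J → ℝ) : Prop :=
  ∀ y : Fin J, ContDiff ℝ 1
    (fun q : EuclideanSpace ℝ (Fin p) × EuclideanSpace ℝ (Fin d) => f q.1 (q.2, y))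

theorem continuous_loss (hf : SmoothLoss f) :
    Continuous fun q : EuclideanSpace ℝ (Fin p) × SampleSpace d J => f q.1 q.2 := by
  have h1 : Continuous fun q : (EuclideanSpace ℝ (Fin p) × EuclideanSpace ℝ (Fin d)) × Fin J =>
      f q.1.1 (q.1.2, q.2) := continuous_prod_of_discrete_right.2 fun y => (hf y).continuous
  exact h1.comp (by fun_prop : Continuous fun q : EuclideanSpace ℝ (Fin p) × SampleSpace d J =>
    ((q.1, q.2.1), q.2.2))

theorem hasFDerivAt_loss (hf : SmoothLoss f)
    (θ : EuclideanSpace ℝ (Fin p)) (ζ : SampleSpace d J) :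
    HasFDerivAt (fun θ => f θ ζ) ((fderiv ℝ (fun q : EuclideanSpace ℝ (Fin p) ×
      EuclideanSpace ℝ (Fin d) => f q.1 (q.2, ζ.2)) (θ, ζ.1)).comp
        (ContinuousLinearMap.inl ℝ _ _)) θ := by
  have h1 : HasFDerivAt (fun q : EuclideanSpace ℝ (Fin p) × EuclideanSpace ℝ (Fin d) =>
      f q.1 (q.2, ζ.2)) _ (θ, ζ.1) := ((hf ζ.2).differentiable one_ne_zero (θ, ζ.1)).hasFDerivAt
  exact HasFDerivAt.comp (f := fun θ => (θ, ζ.1)) θ h1 (hasFDerivAt_prodMk_left θ ζ.1)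

theorem continuous_gradient_loss (hf : SmoothLoss f) :
    Continuous fun q : EuclideanSpace ℝ (Fin p) × SampleSpace d J =>
      gradient (fun θ => f θ q.2) q.1 := by
  have h1 : Continuous fun q : (EuclideanSpace ℝ (Fin p) × EuclideanSpace ℝ (Fin d)) × Fin J =>
      gradient (fun θ => f θ (q.1.2, q.2)) q.1.1 := by
    refine continuous_prod_of_discrete_right.2 fun y => ?_
    have h2 : ∀ q : EuclideanSpace ℝ (Fin p) × EuclideanSpace ℝ (Fin d),
        gradient (fun θ => f θ (q.2, y)) q.1 = (InnerProductSpace.toDual ℝ _).symm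
          ((fderiv ℝ (fun q : EuclideanSpace ℝ (Fin p) × EuclideanSpace ℝ (Fin d) =>
            f q.1 (q.2, y)) q).comp (ContinuousLinearMap.inl ℝ _ _)) := fun q => by
      rw [gradient, (hasFDerivAt_loss hf q.1 (q.2, y)).fderiv]
    simp only [h2]
    refine (LinearIsometryEquiv.continuous _).comp ?_
    exact ((hf y).continuous_fderiv one_ne_zero).clm_comp continuous_const
  exact h1.comp (by fun_prop : Continuous fun q : EuclideanSpace ℝ (Fin p) × SampleSpace d J =>
    ((q.1, q.2.1), q.2.2))

theorem hasGradientAt_potential (hf : SmoothLoss f)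
    (ξ : SampleSpace d J) (w : ParamSpace p) (ζ : SampleSpace d J) :
    HasGradientAt (fun w => potential f κ ξ w ζ) (potentialGradient f κ ξ w ζ) w := by
  have h1 : HasGradientAt (fun θ => f θ ζ) (gradient (fun θ => f θ ζ) w.fst) w.fst :=
    (hasFDerivAt_loss hf w.fst ζ).differentiableAt.hasGradientAt
  have h2 : HasFDerivAt (fun w : ParamSpace p => f w.fst ζ) _ w :=
    h1.hasFDerivAt.comp w (WithLp.fstL 2 ℝ (EuclideanSpace ℝ (Fin p)) ℝ).hasFDerivAt
  have h3 : HasFDerivAt (fun w : ParamSpace p => w.snd * mixedCost κ ξ ζ) _ w :=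
    (WithLp.sndL 2 ℝ (EuclideanSpace ℝ (Fin p)) ℝ).hasFDerivAt.mul_const (mixedCost κ ξ ζ)
  rw [hasGradientAt_iff_hasFDerivAt]
  refine (h2.sub h3).congr_fderiv ?_
  ext v
  simp [potentialGradient, WithLp.prod_inner_apply, mul_comm, sub_eq_add_neg]

theorem continuous_potential (hf : SmoothLoss f)
    (ξ : SampleSpace d J) :
    Continuous fun q : ParamSpace p × SampleSpace d J => potential f κ ξ q.1 q.2 := by
  have h1 := continuous_loss hf
  have h2 := continuous_mixedCost κ ξ
  have h3 : Continuous fun q : ParamSpace p × SampleSpace d J => (q.1.fst, q.2) := by fun_prop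
  have h4 := h1.comp h3
  unfold potential
  exact h4.sub (by fun_prop)

theorem continuous_potentialGradient (hf : SmoothLoss f)
    (ξ : SampleSpace d J) :
    Continuous fun q : ParamSpace p × SampleSpace d J => potentialGradient f κ ξ q.1 q.2 := by
  have h1 := continuous_gradient_loss hf
  have h2 := continuous_mixedCost κ ξ
  have h3 : Continuous fun q : ParamSpace p × SampleSpace d J => (q.1.fst, q.2) := by fun_prop
  have h4 := h1.comp h3
  unfold potentialGradient
  exact (WithLp.prod_continuous_toLp 2 _ _).comp (h4.prodMk (by fun_prop))

/-- The gradient of the linear term `λ ρ`. -/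
noncomputable def linearGradient (p : ℕ) (ρ : ℝ) : ParamSpace p := WithLp.toLp 2 (0, ρ)

theorem hasGradientAt_linear (w : ParamSpace p) :
    HasGradientAt (fun w : ParamSpace p => w.snd * ρ) (linearGradient p ρ) w := by
  have h3 : HasFDerivAt (fun w : ParamSpace p => w.snd * ρ) _ w :=
    (WithLp.sndL 2 ℝ (EuclideanSpace ℝ (Fin p)) ℝ).hasFDerivAt.mul_const ρ
  rw [hasGradientAt_iff_hasFDerivAt]
  refine h3.congr_fderiv ?_
  ext v
  simp [linearGradient, WithLp.prod_inner_apply, mul_comm]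

end Potential

/-! ### The sampled objective -/

section Sampled

variable {E Ξ : Type*} [NormedAddCommGroup E] [InnerProductSpace ℝ E]

theorem hasGradientAt_log_mean_exp [CompleteSpace E] {h : ℕ → E → ℝ} {g : ℕ → E} {w : E}
    (hh : ∀ l, HasGradientAt (h l) (g l) w) {β : ℝ} (hβ : 0 < β) {m : ℕ} (hm : 0 < m) :
    HasGradientAt
      (fun x => β * Real.log (1 / m * ∑ l ∈ Finset.range m, Real.exp (h l x / β)))
      ((∑ l ∈ Finset.range m, Real.exp (h l w / β))⁻¹ •
        ∑ l ∈ Finset.range m, Real.exp (h l w / β) • g l) w := by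
  have hm' : (0 : ℝ) < m := by exact_mod_cast hm
  have hpos : 0 < ∑ l ∈ Finset.range m, Real.exp (h l w / β) :=
    Finset.sum_pos (fun _ _ => Real.exp_pos _) (Finset.nonempty_range_iff.2 hm.ne')
  have h1 : ∀ l ∈ Finset.range m, HasFDerivAt (fun x => Real.exp (h l x / β)) _ w := fun l _ =>
    ((hh l).hasFDerivAt.mul_const β⁻¹).exp
  have h2 := ((HasFDerivAt.fun_sum h1).const_mul (1 / (m : ℝ))).log
    (mul_pos (one_div_pos.2 hm') hpos).ne'
  rw [hasGradientAt_iff_hasFDerivAt]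
  refine (h2.const_mul β).congr_fderiv ?_
  ext v
  simp only [_root_.smul_apply, _root_.sum_apply, smul_eq_mul,
    InnerProductSpace.toDual_apply_apply, inner_smul_left, sum_inner, div_eq_mul_inv,
    conj_trivial, one_mul] at hpos ⊢
  have h3 : ∀ l, Real.exp (h l w * β⁻¹) * (β⁻¹ * inner ℝ (g l) v) =
      β⁻¹ * (Real.exp (h l w * β⁻¹) * inner ℝ (g l) v) := fun l => by ring
  simp only [h3, ← Finset.mul_sum]
  field_simp

theorem continuous_sampledGradient {ι : Type*} [Fintype ι] [TopologicalSpace Ξ] {b : E} {a : ℝ}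
    {h : ι → E → Ξ → ℝ} {g : ι → E → Ξ → E}
    (hh : ∀ i, Continuous fun q : E × Ξ => h i q.1 q.2)
    (hg : ∀ i, Continuous fun q : E × Ξ => g i q.1 q.2) {β : ℝ} {m : ℕ} (hm : 0 < m)
    (ζ : ι → ℕ → Ξ) : Continuous (sampledGradient b a h g β m ζ) := by
  have hh' : ∀ i l, Continuous fun x => h i x (ζ i l) := fun i l =>
    (hh i).comp (by fun_prop : Continuous fun x => (x, ζ i l))
  have hg' : ∀ i l, Continuous fun x => g i x (ζ i l) := fun i l =>
    (hg i).comp (by fun_prop : Continuous fun x => (x, ζ i l))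
  unfold sampledGradient
  refine continuous_const.add (Continuous.const_smul (continuous_finsetSum _ fun i _ => ?_) _)
  refine Continuous.smul (Continuous.inv₀ (by fun_prop) fun x => ?_) (by fun_prop)
  exact (Finset.sum_pos (fun _ _ => Real.exp_pos _) (Finset.nonempty_range_iff.2 hm.ne')).ne'

variable {p d J n : ℕ} {f : EuclideanSpace ℝ (Fin p) → SampleSpace d J → ℝ} {κ ρ : ℝ}

theorem hasGradientAt_sampledObjective (hf : SmoothLoss f) (ξ : Fin n → SampleSpace d J) {β : ℝ}
    (hβ : 0 < β) {m : ℕ} (hm : 0 < m) (ω : ℕ → EuclideanSpace ℝ (Fin d)) (z : ℕ → Fin J)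
    (w : ParamSpace p) :
    HasGradientAt (sampledObjective f κ ρ ξ β m ω z)
      (sampledGradient (linearGradient p ρ) (1 / n) (fun i => potential f κ (ξ i))
        (fun i => potentialGradient f κ (ξ i)) β m (fun i l => ((ξ i).1 + ω l, z l)) w) w := by
  have h1 : sampledObjective f κ ρ ξ β m ω z = fun w => w.snd * ρ + 1 / n * ∑ i,
      β * Real.log (1 / m * ∑ l ∈ Finset.range m,
        Real.exp (potential f κ (ξ i) w ((ξ i).1 + ω l, z l) / β)) := by
    funext w
    rw [sampledObjective, ← Finset.mul_sum, ← mul_assoc, one_div_mul_eq_div]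
    simp only [potential, mixedCost, sub_add_cancel_left, norm_neg, mul_add, sub_sub, mul_assoc]
  have h2 := fun i : Fin n => (hasGradientAt_log_mean_exp (fun l =>
    hasGradientAt_potential (κ := κ) hf (ξ i) w ((ξ i).1 + ω l, z l)) hβ hm).hasFDerivAt
  rw [h1, hasGradientAt_iff_hasFDerivAt]
  refine ((hasGradientAt_linear w).hasFDerivAt.add
    ((HasFDerivAt.fun_sum fun i _ => h2 i).const_mul (1 / (n : ℝ)))).congr_fderiv ?_
  simp only [sampledGradient, map_add, map_sum, map_smul]

end Sampled

/-! ### The dual objective as a maximum of smooth functions -/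

section Dual

variable {p d J n : ℕ} {f : EuclideanSpace ℝ (Fin p) → SampleSpace d J → ℝ} {κ ρ : ℝ}
  {ξ : Fin n → SampleSpace d J}

/-- The dual objective with each supremum replaced by the value at a given point `Z i`. -/
noncomputable def tupleValue (f : EuclideanSpace ℝ (Fin p) → SampleSpace d J → ℝ) (κ ρ : ℝ)
    (ξ : Fin n → SampleSpace d J) (w : ParamSpace p) (Z : Fin n → SampleSpace d J) : ℝ :=
  w.snd * ρ + 1 / n * ∑ i, potential f κ (ξ i) w (Z i)

/-- The gradient of `tupleValue` in `(θ, λ)`. -/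
noncomputable def tupleGradient (f : EuclideanSpace ℝ (Fin p) → SampleSpace d J → ℝ) (κ ρ : ℝ)
    (ξ : Fin n → SampleSpace d J) (w : ParamSpace p) (Z : Fin n → SampleSpace d J) :
    ParamSpace p :=
  linearGradient p ρ + (1 / n : ℝ) • ∑ i, potentialGradient f κ (ξ i) w (Z i)

theorem hasGradientAt_tupleValue (hf : SmoothLoss f) (w : ParamSpace p)
    (Z : Fin n → SampleSpace d J) :
    HasGradientAt (fun w => tupleValue f κ ρ ξ w Z) (tupleGradient f κ ρ ξ w Z) w := by
  rw [hasGradientAt_iff_hasFDerivAt]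
  refine ((hasGradientAt_linear w).hasFDerivAt.add
    ((HasFDerivAt.fun_sum fun i _ => (hasGradientAt_potential hf (ξ i) w (Z i)).hasFDerivAt
      ).const_mul (1 / (n : ℝ)))).congr_fderiv ?_
  simp only [tupleGradient, map_add, map_sum, map_smul]

theorem continuous_tupleGradient (hf : SmoothLoss f) :
    Continuous fun q : ParamSpace p × (Fin n → SampleSpace d J) =>
      tupleGradient f κ ρ ξ q.1 q.2 := by
  have h1 : ∀ i, Continuous fun q : ParamSpace p × (Fin n → SampleSpace d J) =>
      potentialGradient f κ (ξ i) q.1 (q.2 i) := fun i =>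
    (continuous_potentialGradient hf (ξ i)).comp (by fun_prop :
      Continuous fun q : ParamSpace p × (Fin n → SampleSpace d J) => (q.1, q.2 i))
  unfold tupleGradient
  fun_prop

theorem coe_tupleValue (w : ParamSpace p) (Z : Fin n → SampleSpace d J) :
    (tupleValue f κ ρ ξ w Z : EReal) = ((w.snd * ρ : ℝ) : EReal) +
      ((1 / n : ℝ) : EReal) * ∑ i, (potential f κ (ξ i) w (Z i) : EReal) := by
  have h1 : ∀ s : Finset (Fin n), ((∑ i ∈ s, potential f κ (ξ i) w (Z i) : ℝ) : EReal) =
      ∑ i ∈ s, (potential f κ (ξ i) w (Z i) : EReal) := fun s =>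
    map_sum (⟨⟨Real.toEReal, EReal.coe_zero⟩, EReal.coe_add⟩ : ℝ →+ EReal) _ s
  rw [tupleValue, EReal.coe_add, EReal.coe_mul (1 / n : ℝ), h1]

theorem tupleValue_le_dualObjective (w : ParamSpace p) (Z : Fin n → SampleSpace d J) :
    (tupleValue f κ ρ ξ w Z : EReal) ≤ dualObjective f (mixedCost κ) ρ ξ w := by
  rw [coe_tupleValue, dualObjective]
  have h0 : (0 : EReal) ≤ ((1 / n : ℝ) : EReal) := EReal.coe_nonneg.2 (by positivity)
  refine add_le_add le_rfl (mul_le_mul_of_nonneg_left (Finset.sum_le_sum fun i _ => ?_) h0)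
  exact le_iSup (fun ζ => ((f w.fst ζ - w.snd * mixedCost κ (ξ i) ζ : ℝ) : EReal)) (Z i)

theorem dualObjective_eq_tupleValue {w : ParamSpace p} {Z : Fin n → SampleSpace d J}
    (hZ : ∀ i ζ, potential f κ (ξ i) w ζ ≤ potential f κ (ξ i) w (Z i)) :
    dualObjective f (mixedCost κ) ρ ξ w = (tupleValue f κ ρ ξ w Z : EReal) := by
  rw [coe_tupleValue, dualObjective]
  congr 2
  refine Finset.sum_congr rfl fun i _ => le_antisymm ?_ ?_
  · exact iSup_le fun ζ => EReal.coe_le_coe (hZ i ζ)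
  · exact le_iSup (fun ζ => ((f w.fst ζ - w.snd * mixedCost κ (ξ i) ζ : ℝ) : EReal)) (Z i)

theorem tupleValue_le_of_forall_potential_le {w : ParamSpace p} {Z : Fin n → SampleSpace d J}
    (hZ : ∀ i ζ, potential f κ (ξ i) w ζ ≤ potential f κ (ξ i) w (Z i))
    (Z' : Fin n → SampleSpace d J) : tupleValue f κ ρ ξ w Z' ≤ tupleValue f κ ρ ξ w Z :=
  add_le_add le_rfl (mul_le_mul_of_nonneg_left (Finset.sum_le_sum fun i _ => hZ i _)
    (by positivity))

theorem exists_le_potential_self (hf : SmoothLoss f) {S : Set (ParamSpace p)}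
    (hS : Bornology.IsBounded S) :
    ∃ b : ℝ, ∀ x ∈ S, ∀ i, b ≤ potential f κ (ξ i) x (ξ i) := by
  have h1 : ∀ i, ∃ b : ℝ, ∀ x ∈ S, b ≤ potential f κ (ξ i) x (ξ i) := by
    intro i
    have hcont : Continuous fun x => potential f κ (ξ i) x (ξ i) :=
      (continuous_potential hf (ξ i)).comp (by fun_prop : Continuous fun x => (x, ξ i))
    obtain ⟨b, hb⟩ := hS.isCompact_closure.bddBelow_image hcont.continuousOn
    exact ⟨b, fun x hx => hb ⟨x, subset_closure hx, rfl⟩⟩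
  choose b hb using h1
  obtain ⟨b', hb'⟩ := (finite_range b).bddBelow
  exact ⟨b', fun x hx i => (hb' (mem_range_self i)).trans (hb i x hx)⟩

/-- Uniform growth of the potentials on a bounded set makes the dual objective a maximum over a
compact set of tuples there. -/
theorem exists_maximumOn_dualObjective (hf : SmoothLoss f)
    (hc : ∀ ξ : SampleSpace d J, Coercive (mixedCost κ ξ)) {S : Set (ParamSpace p)}
    (hS : Bornology.IsBounded S) {δ : ℝ} {C : Fin n → ℝ} (hδ : 0 < δ)
    (hgrow : ∀ x ∈ S, ∀ i ζ, potential f κ (ξ i) x ζ ≤ C i - δ * mixedCost κ (ξ i) ζ) :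
    ∃ Z : Set (Fin n → SampleSpace d J), IsCompact Z ∧
      MaximumOn (dualObjective f (mixedCost κ) ρ ξ) (tupleValue f κ ρ ξ) S Z := by
  obtain ⟨b, hb⟩ := exists_le_potential_self (κ := κ) (ξ := ξ) hf hS
  refine ⟨univ.pi fun i => {ζ | mixedCost κ (ξ i) ζ ≤ (C i - b) / δ},
    isCompact_univ_pi fun i => (hc (ξ i)).2 _, fun x hx => ?_⟩
  have hcont : ∀ i, Continuous (potential f κ (ξ i) x) := fun i =>
    (continuous_potential hf (ξ i)).comp (by fun_prop : Continuous fun ζ => (x, ζ))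
  choose Z hZmem hZmax using fun i =>
    exists_maximizer_of_growth (hc (ξ i)) (hcont i) hδ (hgrow x hx i) (hb x hx i)
  exact ⟨Z, fun i _ => hZmem i, tupleValue_le_of_forall_potential_le hZmax,
    dualObjective_eq_tupleValue hZmax⟩

/-- Where the dual objective is finite and bounded, so are the potentials; decreasing the multiplier
`λ` slightly turns this bound into growth. -/
theorem exists_growth_of_finiteLipschitzNear (hn : 0 < n) (hf : SmoothLoss f) {w : ParamSpace p}
    (hw : FiniteLipschitzNear (dualObjective f (mixedCost κ) ρ ξ) w) :
    ∃ r > 0, ∃ δ > 0, ∃ C : Fin n → ℝ, ∀ x ∈ Metric.ball w r, ∀ i ζ,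
      potential f κ (ξ i) x ζ ≤ C i - δ * mixedCost κ (ξ i) ζ := by
  obtain ⟨hfin, U, hU, L, hL⟩ := hw
  obtain ⟨r, hr, hball⟩ := Metric.eventually_nhds_iff_ball.1 (hfin.and hU)
  obtain ⟨b, hb⟩ := exists_le_potential_self (κ := κ) (ξ := ξ) hf
    (Metric.isBounded_ball (x := w) (r := r))
  set B := (dualObjective f (mixedCost κ) ρ ξ w).toReal + L * r
  have hB : ∀ x ∈ Metric.ball w r, ∀ Z, tupleValue f κ ρ ξ x Z ≤ B := by
    intro x hx Z
    have h1 : tupleValue f κ ρ ξ x Z ≤ (dualObjective f (mixedCost κ) ρ ξ x).toReal := by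
      have h := tupleValue_le_dualObjective (f := f) (κ := κ) (ρ := ρ) (ξ := ξ) x Z
      rw [← EReal.coe_toReal (hball x hx).1.1 (hball x hx).1.2] at h
      exact EReal.coe_le_coe_iff.1 h
    have h2 := hL.le_add_mul (hball x hx).2 (hball w (Metric.mem_ball_self hr)).2
    have h3 : (L : ℝ) * dist x w ≤ L * r :=
      mul_le_mul_of_nonneg_left (Metric.mem_ball.1 hx).le L.2
    exact h1.trans (h2.trans (add_le_add le_rfl h3))
  have hn' : (0 : ℝ) < n := by exact_mod_cast hn
  set C := n * (B + (|w.snd| + r) * |ρ|) - (n - 1) * b with hC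
  have hpot : ∀ x ∈ Metric.ball w r, ∀ i ζ, potential f κ (ξ i) x ζ ≤ C := by
    intro x hx i ζ
    -- all entries other than the `i`-th are chosen at the data points
    have h1 := hB x hx (Function.update ξ i ζ)
    have h2 : potential f κ (ξ i) x ζ + (n - 1) * b ≤
        ∑ j, potential f κ (ξ j) x (Function.update ξ i ζ j) := by
      rw [← Finset.add_sum_erase _ _ (Finset.mem_univ i), Function.update_self]
      refine add_le_add le_rfl ?_
      have h3 := Finset.card_nsmul_le_sum (Finset.univ.erase i)
        (fun j => potential f κ (ξ j) x (Function.update ξ i ζ j)) b fun j hj => by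
          rw [Function.update_of_ne (Finset.ne_of_mem_erase hj)]
          exact hb x hx j
      rwa [Finset.card_erase_of_mem (Finset.mem_univ i), Finset.card_univ, Fintype.card_fin,
        nsmul_eq_mul, Nat.cast_sub hn, Nat.cast_one] at h3
    have h4 : -(x.snd * ρ) ≤ (|w.snd| + r) * |ρ| := by
      refine (neg_le_abs _).trans ?_
      rw [abs_mul]
      refine mul_le_mul_of_nonneg_right ?_ (abs_nonneg ρ)
      have h5 : dist x.snd w.snd < r := (WithLp.dist_snd_le x w).trans_lt hx
      rw [Real.dist_eq] at h5
      linarith [abs_sub_abs_le_abs_sub x.snd w.snd]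
    rw [tupleValue, one_div] at h1
    have h6 : (n : ℝ)⁻¹ * ∑ j, potential f κ (ξ j) x (Function.update ξ i ζ j) ≤
        B + (|w.snd| + r) * |ρ| := by linarith
    rw [inv_mul_le_iff₀ hn'] at h6
    linarith
  refine ⟨r / 2, by positivity, r / 2, by positivity, fun _ => C, fun x hx i ζ => ?_⟩
  -- lower the multiplier by `r / 2`
  set e : ParamSpace p := WithLp.toLp 2 (0, r / 2) with he
  have hx' : x - e ∈ Metric.ball w r := by
    rw [Metric.mem_ball, dist_eq_norm] at hx ⊢
    have h1 : ‖e‖ = r / 2 := by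
      rw [he, WithLp.norm_toLp_snd, Real.norm_of_nonneg (by positivity)]
    calc ‖x - e - w‖ = ‖(x - w) - e‖ := by congr 1; abel
      _ ≤ ‖x - w‖ + ‖e‖ := norm_sub_le _ _
      _ < r := by rw [h1]; linarith
  have h1 := hpot _ hx' i ζ
  have h2 : potential f κ (ξ i) (x - e) ζ =
      potential f κ (ξ i) x ζ + r / 2 * mixedCost κ (ξ i) ζ := by
    simp only [potential, he, WithLp.sub_fst, WithLp.sub_snd, WithLp.toLp_fst, WithLp.toLp_snd,
      sub_zero]
    ring
  linarith

end Dual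

/-! ### Consistency of the critical points -/

section CriticalPoints

variable {p d J n : ℕ} {Θ : Set (EuclideanSpace ℝ (Fin p))}
  {f : EuclideanSpace ℝ (Fin p) → SampleSpace d J → ℝ} {mu lam : SampleSpace d J → ℝ}
  {κ σ ρ lmax : ℝ} {ξ : Fin n → SampleSpace d J}

theorem convex_feasibleSet {Λ : Set ℝ} (hΘ : Convex ℝ Θ) (hΛ : Convex ℝ Λ) :
    Convex ℝ (feasibleSet Θ Λ) :=
  fun _ hx _ hy _ _ ha hb hab => ⟨hΘ hx.1 hy.1 ha hb hab, hΛ hx.2 hy.2 ha hb hab⟩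

theorem isCompact_feasibleSet {Λ : Set ℝ} (hΘ : IsCompact Θ) (hΛ : IsCompact Λ) :
    IsCompact (feasibleSet Θ Λ) := by
  have h1 := (hΘ.prod hΛ).image (WithLp.prod_continuous_toLp 2 (EuclideanSpace ℝ (Fin p)) ℝ)
  convert h1 using 1
  ext w
  exact ⟨fun hw => ⟨(w.fst, w.snd), hw, rfl⟩, by rintro ⟨q, hq, rfl⟩; exact hq⟩

/-- On `Θ`, multipliers bounded below by `lam ξᵢ / 2 + δ` leave a growth margin `δ`. -/
theorem potential_le_of_growth (hf : LossAssumption Θ f (mixedCost κ) (mixedReference σ) mu lam)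
    {ξ : SampleSpace d J} {δ : ℝ} {w : ParamSpace p} (hw : w.fst ∈ Θ) (hδ : lam ξ / 2 + δ ≤ w.snd)
    (ζ : SampleSpace d J) : potential f κ ξ w ζ ≤ mu ξ - δ * mixedCost κ ξ ζ := by
  have h1 := hf.growth ξ w.fst hw ζ
  have h2 := mul_le_mul_of_nonneg_right hδ (hf.cost_nonneg ξ ζ)
  rw [potential]
  linarith

theorem integrable_of_integrable_rpow {X : Type*} [MeasurableSpace X] {μ : Measure X}
    [IsFiniteMeasure μ] {φ : X → ℝ} (hφ : AEStronglyMeasurable φ μ) (h0 : ∀ x, 0 ≤ φ x) {a : ℝ}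
    (ha : 0 < a) (hint : Integrable (fun x => φ x ^ (1 + a)) μ) : Integrable φ μ := by
  refine ((integrable_const (1 : ℝ)).add hint).mono' hφ (Eventually.of_forall fun x => ?_)
  rw [Real.norm_of_nonneg (h0 x), Pi.add_apply]
  rcases le_total (φ x) 1 with h | h
  · linarith [Real.rpow_nonneg (h0 x) (1 + a)]
  · linarith [Real.self_le_rpow_of_one_le h (by linarith : (1 : ℝ) ≤ 1 + a)]

theorem gibbsControl_potential (hJ : 0 < J)
    (hf : LossAssumption Θ f (mixedCost κ) (mixedReference σ) mu lam) (ξ : SampleSpace d J)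
    {K : Set (ParamSpace p)} (hKne : K.Nonempty) {δ : ℝ} (hδ : 0 < δ)
    (hK : ∀ w ∈ K, w.fst ∈ Θ ∧ lam ξ / 2 + δ ≤ w.snd) :
    GibbsControl (mixedReference σ ξ) (potential f κ ξ) (potentialGradient f κ ξ) K := by
  obtain ⟨a, ha, ψ, hψ, hcint, hgrad, hψint⟩ := hf.integrability
  have := isProbabilityMeasure_mixedLaw hJ σ ξ.1
  have : IsProbabilityMeasure (mixedReference σ ξ) := this
  obtain ⟨w₀, hw₀⟩ := hKne
  have hψ0 : ∀ ζ, 0 ≤ ψ ζ := fun ζ =>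
    (norm_nonneg _).trans (hgrad ζ w₀.fst (hK w₀ hw₀).1).le
  refine ⟨continuous_potential hf.smooth ξ, continuous_potentialGradient hf.smooth ξ,
    mixedCost κ ξ, fun ζ => ψ ζ + mixedCost κ ξ ζ, mu ξ, δ, hf.cost_coercive ξ,
    hf.cost_nonneg ξ, hδ, fun w hw => potential_le_of_growth hf (hK w hw).1 (hK w hw).2,
    fun w hw ζ => ?_, Integrable.add ?_ ?_⟩
  · have h1 : potentialGradient f κ ξ w ζ = WithLp.toLp 2 (gradient (fun θ => f θ ζ) w.fst, 0) +
        WithLp.toLp 2 (0, -mixedCost κ ξ ζ) := by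
      rw [potentialGradient, ← WithLp.toLp_add]
      simp
    rw [h1]
    refine (norm_add_le _ _).trans ?_
    rw [WithLp.norm_toLp_fst, WithLp.norm_toLp_snd, norm_neg,
      Real.norm_of_nonneg (hf.cost_nonneg ξ ζ)]
    exact add_le_add (hgrad ζ w.fst (hK w hw).1).le le_rfl
  · exact integrable_of_integrable_rpow hψ.1.aestronglyMeasurable hψ0 ha (hψint ξ)
  · exact integrable_of_integrable_rpow (continuous_mixedCost κ ξ).aestronglyMeasurable
      (hf.cost_nonneg ξ) ha (hcint ξ)

/-- Either assumption on `F` provides, at each point of `𝒦`, a bounded convex set with nonempty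
interior that contains a relative neighbourhood of the point in `𝒦` and on which the potentials have
uniform growth. -/
theorem exists_convex_growth (hn : 0 < n) (hΘ_compact : IsCompact Θ) (hΘ_convex : Convex ℝ Θ)
    (hf : LossAssumption Θ f (mixedCost κ) (mixedReference σ) mu lam)
    {l₀ : ℝ} (hl₀ : 0 < l₀) (hlam : ∀ i, lam (ξ i) ≤ l₀) {Λ : Set ℝ} (hΛ : Λ ⊆ Icc l₀ lmax)
    (hF : (interior Θ).Nonempty ∨
      ∀ w ∈ feasibleSet Θ Λ, FiniteLipschitzNear (dualObjective f (mixedCost κ) ρ ξ) w)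
    {w : ParamSpace p} (hw : w ∈ feasibleSet Θ Λ) :
    ∃ S : Set (ParamSpace p), Convex ℝ S ∧ (interior S).Nonempty ∧ Bornology.IsBounded S ∧
      (∀ᶠ x in 𝓝 w, x ∈ feasibleSet Θ Λ → x ∈ S) ∧ ∃ δ > 0, ∃ C : Fin n → ℝ,
        ∀ x ∈ S, ∀ i ζ, potential f κ (ξ i) x ζ ≤ C i - δ * mixedCost κ (ξ i) ζ := by
  rcases hF with ⟨θ, hθ⟩ | hF
  -- widening `Λ` to both sides gives interior even if it is a single point; its lower end stays
  -- above `l₀ / 2` by a margin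
  · have hwΛ := hΛ hw.2
    refine ⟨feasibleSet Θ (Icc (3 / 4 * l₀) (lmax + 1)),
      convex_feasibleSet hΘ_convex (convex_Icc _ _), ?_,
      (isCompact_feasibleSet hΘ_compact isCompact_Icc).isBounded,
      Eventually.of_forall fun x hx => ⟨hx.1, ?_, ?_⟩, l₀ / 4, by positivity,
      fun i => mu (ξ i), fun x hx i => potential_le_of_growth hf hx.1 ?_⟩
    · refine ⟨WithLp.toLp 2 (θ, w.snd), mem_interior.2 ⟨{x | x.fst ∈ interior Θ ∧
        x.snd ∈ Ioo (3 / 4 * l₀) (lmax + 1)}, fun x hx => ⟨interior_subset hx.1,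
          Ioo_subset_Icc_self hx.2⟩, ?_, hθ, ?_, ?_⟩⟩
      · exact (isOpen_interior.preimage (WithLp.continuous_fst 2 _ _)).inter
          (isOpen_Ioo.preimage (WithLp.continuous_snd 2 _ _))
      · simp only [WithLp.toLp_snd]
        linarith [hwΛ.1]
      · simp only [WithLp.toLp_snd]
        linarith [hwΛ.2]
    · linarith [(hΛ hx.2).1]
    · linarith [(hΛ hx.2).2]
    · linarith [hlam i, hx.2.1]
  · obtain ⟨r, hr, δ, hδ, C, hgrow⟩ := exists_growth_of_finiteLipschitzNear hn hf.smooth (hF w hw)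
    refine ⟨Metric.ball w r, convex_ball w r, ?_, Metric.isBounded_ball,
      mem_of_superset (Metric.ball_mem_nhds w hr) fun x hx _ => hx,
      δ, hδ, C, hgrow⟩
    rw [Metric.isOpen_ball.interior_eq]
    exact ⟨w, Metric.mem_ball_self hr⟩

/-- A point of `𝒦` is critical as soon as every feasible direction has nonnegative slope along some
tuple of maximizers. -/
theorem mem_criticalSet_dualObjective
    (hf : LossAssumption Θ f (mixedCost κ) (mixedReference σ) mu lam) {K S : Set (ParamSpace p)}
    (hK : Convex ℝ K) (hS : Convex ℝ S) (hSne : (interior S).Nonempty)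
    (hSb : Bornology.IsBounded S) {w : ParamSpace p} (hw : w ∈ K)
    (hKS : ∀ᶠ x in 𝓝 w, x ∈ K → x ∈ S) {δ : ℝ} (hδ : 0 < δ) {C : Fin n → ℝ}
    (hgrow : ∀ x ∈ S, ∀ i ζ, potential f κ (ξ i) x ζ ≤ C i - δ * mixedCost κ (ξ i) ζ)
    (hcrit : ∀ u ∈ K, ∃ Z : Fin n → SampleSpace d J,
      (∀ i ζ, potential f κ (ξ i) w ζ ≤ potential f κ (ξ i) w (Z i)) ∧
      0 ≤ inner ℝ (tupleGradient f κ ρ ξ w Z) (u - w)) :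
    w ∈ criticalSet (dualObjective f (mixedCost κ) ρ ξ) K := by
  obtain ⟨Z, hZ, hmax⟩ := exists_maximumOn_dualObjective (ρ := ρ) hf.smooth hf.cost_coercive hSb hδ
    hgrow
  refine hmax.mem_criticalSet (hasGradientAt_tupleValue hf.smooth)
    (continuous_tupleGradient hf.smooth) hZ hS hSne hK hw hKS fun u hu => ?_
  obtain ⟨Z', hZ', hslope⟩ := hcrit u hu
  exact ⟨Z', tupleValue_le_of_forall_potential_le hZ', hslope⟩

/-- The multiplier set is a compact interval, with lower end the largest of the `lam ξᵢ`. -/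
theorem exists_multiplierSet_eq (hn : 0 < n) (lam : SampleSpace d J → ℝ) (lmax : ℝ)
    (ξ : Fin n → SampleSpace d J) :
    ∃ l₀, (∀ i, lam (ξ i) ≤ l₀) ∧ multiplierSet lam lmax ξ = Icc l₀ lmax := by
  have : Nonempty (Fin n) := ⟨⟨0, hn⟩⟩
  obtain ⟨i₀, hi₀⟩ := Finite.exists_max fun i => lam (ξ i)
  refine ⟨lam (ξ i₀), hi₀, Subset.antisymm (iInter_subset _ i₀) fun x hx => ?_⟩
  exact mem_iInter.2 fun i => ⟨(hi₀ i).trans hx.1, hx.2⟩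

end CriticalPoints

theorem mainTheorem2 {p d J n : ℕ} (hJ : 0 < J) (hn : 0 < n)
    (Θ : Set (EuclideanSpace ℝ (Fin p))) (hΘ_compact : IsCompact Θ) (hΘ_convex : Convex ℝ Θ)
    (f : EuclideanSpace ℝ (Fin p) → SampleSpace d J → ℝ)
    (mu lam : SampleSpace d J → ℝ)
    (κ σ ρ lmax : ℝ) (hκ : 0 < κ) (hσ : 0 < σ) (hρ : 0 < ρ) (hlmax : 0 < lmax)
    (ξ : Fin n → SampleSpace d J)
    (hf : LossAssumption Θ f (mixedCost κ) (mixedReference σ) mu lam)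
    (hΛ : multiplierSet lam lmax ξ ⊆ Set.Ioi 0)
    (hF : (interior Θ).Nonempty ∨
      ∀ w ∈ feasibleSet Θ (multiplierSet lam lmax ξ),
        FiniteLipschitzNear (dualObjective f (mixedCost κ) ρ ξ) w) :
    ∀ ε : ℝ, 0 < ε → ∃ βbar : ℝ, 0 < βbar ∧ ∀ β ∈ Set.Ioc 0 βbar,
      ∀ (Ω : Type*) [MeasurableSpace Ω] (P : Measure Ω) [IsProbabilityMeasure P]
        (ω : ℕ → Ω → EuclideanSpace ℝ (Fin d)) (z : ℕ → Ω → Fin J),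
        (∀ l, HasLaw (fun s => (ω l s, z l s)) (mixedLaw J σ 0) P) →
        iIndepFun (fun l s => (ω l s, z l s)) P →
        ∀ᵐ s ∂P, ∃ mbar : ℕ, ∀ m ≥ mbar,
          criticalSet
              (fun w => (sampledObjective f κ ρ ξ β m (fun l => ω l s) (fun l => z l s) w : EReal))
              (feasibleSet Θ (multiplierSet lam lmax ξ)) ⊆
            criticalSet (dualObjective f (mixedCost κ) ρ ξ)
              (feasibleSet Θ (multiplierSet lam lmax ξ)) + Metric.closedBall 0 ε := by
  intro ε hε
  obtain ⟨l₀, hlam, hΛeq⟩ := exists_multiplierSet_eq hn lam lmax ξ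
  set K := feasibleSet Θ (multiplierSet lam lmax ξ) with hKdef
  rcases K.eq_empty_or_nonempty with hKe | hKne
  · refine ⟨1, one_pos, fun β _ Ω _ P _ ω z _ _ => Eventually.of_forall fun s =>
      ⟨0, fun m _ w hw => ?_⟩⟩
    exact absurd (hKe ▸ hw.1) (notMem_empty w)
  have hl₀ : 0 < l₀ := by
    obtain ⟨w, hw⟩ := hKne
    have h1 := hw.2
    rw [hΛeq] at h1
    exact hΛ (hΛeq ▸ left_mem_Icc.2 (h1.1.trans h1.2))
  have hKcomp : IsCompact K := by
    rw [hKdef, hΛeq]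
    exact isCompact_feasibleSet hΘ_compact isCompact_Icc
  have hKconv : Convex ℝ K := by
    rw [hKdef, hΛeq]
    exact convex_feasibleSet hΘ_convex (convex_Icc _ _)
  have hctrl : ∀ i, GibbsControl (mixedReference σ (ξ i)) (potential f κ (ξ i))
      (potentialGradient f κ (ξ i)) K := fun i =>
    gibbsControl_potential hJ hf (ξ i) hKne (half_pos hl₀) fun w hw => ⟨hw.1, by
      have h1 := hw.2
      rw [hΛeq] at h1
      linarith [h1.1, hlam i]⟩
  have hprob : ∀ i, IsProbabilityMeasure (mixedReference σ (ξ i)) := fun i =>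
    isProbabilityMeasure_mixedLaw hJ σ (ξ i).1
  have hopen : ∀ i, (mixedReference σ (ξ i)).IsOpenPosMeasure := fun i =>
    isOpenPosMeasure_mixedLaw hJ hσ (ξ i).1
  obtain ⟨βbar, hβbar, hnear⟩ := exists_forall_exists_dist_lt (b := linearGradient p ρ)
    (a := 1 / n) (T := criticalSet (dualObjective f (mixedCost κ) ρ ξ) K) (by positivity) hKcomp
    hctrl (fun w hw hcrit => by
      obtain ⟨S, hS, hSne, hSb, hKS, δ, hδ, C, hgrow⟩ := exists_convex_growth hn hΘ_compact
        hΘ_convex hf hl₀ hlam hΛeq.subset hF hw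
      exact mem_criticalSet_dualObjective hf hKconv hS hSne hSb hw hKS hδ hgrow hcrit) hε
  refine ⟨βbar, hβbar, fun β hβ Ω _ P _ ω z hlaw hindep => ?_⟩
  filter_upwards [ae_exists_forall_exists_dist_lt hKcomp hctrl hβ.1 (hnear β hβ)
    (ζ := fun i l s => ((ξ i).1 + ω l s, z l s))
    (fun i l => (hasLaw_shift hJ σ (ξ i).1).comp (hlaw l))
    (fun i => hindep.comp (fun _ ζ => ((ξ i).1 + ζ.1, ζ.2)) fun _ => by fun_prop)] with s hs
  obtain ⟨mbar, hmbar⟩ := hs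
  -- with `m ≥ 1` the sample means of the exponentials are positive, so the logarithms are smooth
  refine ⟨max mbar 1, fun m hm w hw => ?_⟩
  have hm1 : 0 < m := (le_max_right _ _).trans hm
  have hvar := inner_nonneg_of_mem_criticalSet
    (hasGradientAt_sampledObjective hf.smooth ξ hβ.1 hm1 (fun l => ω l s) (fun l => z l s))
    (continuous_sampledGradient (fun i => (hctrl i).continuous)
      (fun i => (hctrl i).continuous_grad) hm1 _) hw
  obtain ⟨v, hv, hdist⟩ := hmbar m ((le_max_left _ _).trans hm) w hw.1 hvar
  refine ⟨v, hv, w - v, ?_, by simp⟩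
  rw [mem_closedBall_zero_iff, ← dist_eq_norm]
  exact hdist.le
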